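/- **Setting.** ZF is classical first-order set theory with equality (extensionality, separation schema, pairing, union, power set, replacement schema, infinity, foundation), and $\vdash_{ZF}$ is derivability in first-order logic from these axioms. The syntactic category $\mathbb{ZF}$ has as objects the formulas in context $\{x_1,\dots,x_n\mid P\}$. An arrow from $\{\mathbf x\mid P\}$ to $\{\mathbf y\mid Q\}$ is a class $[\{\mathbf x,\mathbf y\mid F\}]$, up to ZF-provable equivalence, of formulas $F$ with $F\vdash_{ZF}P\wedge Q$, $\;F\wedge F[\mathbf y'/\mathbf y]\vdash_{ZF}\mathbf y=\mathbf y'$ and $P\vdash_{ZF}\exists\mathbf y\,F$; composition is $[\exists\mathbf y(F\wedge G)]$. $\mathbb{DCL}[ZF]$ is the full subcategory on the contexts of length one, and $\mathbb{DST}[ZF]$ (definable sets) is the full subcategory of $\mathbb{DCL}[ZF]$ on the $\{x\mid P\}$ with $\vdash_{ZF}\exists z\forall x(x\in z\leftrightarrow P)$. $\mathcal{SET}$ is the internal category of $\mathbb{ZF}$ with object of objects $\{x\mid x=x\}$ and object of arrows $\{F\mid\exists f\exists z(F=\langle f,z\rangle\wedge \mathrm{Fun}(f)\wedge \mathrm{ran}(f)\subseteq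 z)\}$. The domain of $\langle f,z\rangle$ is $\mathrm{dom}(f)$ and its codomain is $z$, the identity of $x$ is $\langle \mathrm{id}_x,x\rangle$, and composition is composition of functions. Pairs are Kuratowski pairs, and $\mathrm{Fun}(f)$ says that $f$ is a single-valued set of ordered pairs. $\Gamma(\mathcal{SET})$ is the category of its global elements: with $1=\{\;\mid\forall x(x=x)\}$, a terminal object of $\mathbb{ZF}$, its objects are the arrows $1\to\mathcal{SET}_0$, its arrows are the arrows $1\to\mathcal{SET}_1$ with the induced domain and codomain, and identities and composition are induced by those of $\mathcal{SET}$. A global element is written $[\{x\mid P(x)\}]$ for a formula $P$ in one variable that represents it. **Theorem.** 1. A formula $P(x)$ represents an object of $\Gamma(\mathcal{SET})$ if and only if $\vdash_{ZF}\exists!x\,P(x)$. A formula $Q(f)$ represents an arrow of $\Gamma(\mathcal{SET})$ if and only if $\vdash_{ZF}\exists!f\,Q(f)$ and $Q(f)\vdash_{ZF}\exists f'\exists z(f=\langle f',z\rangle\wedge \mathrm{Fun}(f')\wedge \mathrm{ran}(f')\subseteq z)$. 2. The categories $\mathbb{DST}[ZF]$ and $\Gamma(\mathcal{SET})$ are equivalent.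 More precisely, for every choice of a representing formula $P_X$ for each object $X$ of $\Gamma(\mathcal{SET})$, there is an equivalence given by functors $\mathbf P:\mathbb{DST}[ZF]\to\Gamma(\mathcal{SET})$ and $\mathbf P':\Gamma(\mathcal{SET})\to\mathbb{DST}[ZF]$ such that * $\mathbf P(\{x\mid P\})=[\{z\mid\forall x(x\in z\leftrightarrow P(x))\}]$; * for $[\{x,y\mid F\}]:\{x\mid P\}\to\{y\mid Q\}$, the arrow $\mathbf P([\{x,y\mid F\}])$ is $[\{f'\mid\exists f\exists z(f'=\langle f,z\rangle\wedge\forall t(t\in f\leftrightarrow\exists x\exists y(t=\langle x,y\rangle\wedge F(x,y)))\wedge\forall y(y\in z\leftrightarrow Q(y)))\}]$; * $\mathbf P'(X)=\{x\mid\exists z(P_X(z)\wedge x\in z)\}$; * $\mathbf P'([\{f'\mid Q(f')\}])=[\{x,x'\mid\exists f'(Q(f')\wedge\exists z\exists f(f'=\langle f,z\rangle\wedge\langle x,x'\rangle\in f))\}]$; * the unit of the equivalence, from the identity functor to $\mathbf P'\circ\mathbf P$, has component $[\{x,x'\mid P(x)\wedge x=x'\}]$ at $\{x\mid P\}$; *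 $\mathbf P\circ\mathbf P'$ is the identity functor of $\Gamma(\mathcal{SET})$. -/

import Mathlib

open FirstOrder FirstOrder.Language CategoryTheory

namespace DefSet

/-! ### The language of set theory -/

/-- The only non-logical symbol: a binary relation symbol for membership. -/
inductive MemSymbol : ℕ → Type
  | mem : MemSymbol 2

/-- The first-order language (with equality) of set theory. -/
def LSet : FirstOrder.Language.{0, 0} := ⟨fun _ => Empty, MemSymbol⟩

/-- Formulas of set theory with free variables in `α` and `n` bound variables in scope. -/
abbrev BFml (α : Type) (n : ℕ) := LSet.BoundedFormula α n

/-- Formulas of set theory with free variables in `α`. -/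
abbrev Fml (α : Type) := LSet.Formula α

/-- Free variables. -/
abbrev fv {α : Type} {n : ℕ} (a : α) : α ⊕ Fin n := Sum.inl a

/-- Bound variables; the `i`-th one is bound by the `i`-th quantifier, counted from the outside. -/
abbrev bv {α : Type} {n : ℕ} (i : Fin n) : α ⊕ Fin n := Sum.inr i

/-- The atomic formula `u ∈ v`. -/
def memF {α : Type} {n : ℕ} (u v : α ⊕ Fin n) : BFml α n :=
  BoundedFormula.rel (L := LSet) MemSymbol.mem ![Term.var u, Term.var v]

/-- The atomic formula `u = v`. -/
def eqF {α : Type} {n : ℕ} (u v : α ⊕ Fin n) : BFml α n :=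
  BoundedFormula.equal (L := LSet) (Term.var u) (Term.var v)

infix:90 " ∈' " => memF
infix:90 " ≐ " => eqF

/-! ### Renaming of variables -/

/-- The extension of a renaming under one more quantifier. -/
def up {α β : Type} {n m : ℕ} (ρ : α ⊕ Fin n → β ⊕ Fin m) : α ⊕ Fin (n + 1) → β ⊕ Fin (m + 1) :=
  Sum.elim (fun a => Sum.map id Fin.castSucc (ρ (Sum.inl a)))
    (Fin.lastCases (Sum.inr (Fin.last m)) fun i => Sum.map id Fin.castSucc (ρ (Sum.inr i)))

/-- Simultaneous capture-avoiding substitution of variables for the variables in scope. As the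
language has no function symbols, every term is a variable, so this is substitution of terms. -/
def ren {α β : Type} : ∀ {n m : ℕ}, (α ⊕ Fin n → β ⊕ Fin m) → BFml α n → BFml β m
  | _, _, _, .falsum => .falsum
  | _, _, ρ, .equal t s => .equal (t.relabel ρ) (s.relabel ρ)
  | _, _, ρ, .rel R ts => .rel R fun i => (ts i).relabel ρ
  | _, _, ρ, .imp φ ψ => .imp (ren ρ φ) (ren ρ ψ)
  | _, _, ρ, .all φ => .all (ren (up ρ) φ)

/-- Substitution of variables in scope for the free variables of a formula. -/
def app {α β : Type} {m : ℕ} (φ : Fml α) (f : α → β ⊕ Fin m) : BFml β m :=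
  ren (Sum.elim f Fin.elim0) φ

/-! ### Provability -/

/-- The formula `φ` with its free variables named by the variables `v₀, v₁, …`. -/
def named {α : Type} [Encodable α] (φ : Fml α) : Fml ℕ :=
  app φ fun a => fv (Encodable.encode a)

/-- Natural deduction for classical first-order logic with equality; the free variables are
`v₀, v₁, …`, and `Derives T Γ φ` says that `φ` is derivable from the axioms in `T` and the open
assumptions in `Γ`. In the rule `all_intro`, the variable `v₀` is made fresh by shifting all
other free variables by one. -/
inductive Derives (T : LSet.Theory) : List (Fml ℕ) → Fml ℕ → Prop
  | hyp {Γ φ} : φ ∈ Γ → Derives T Γ φ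
  | ax {Γ σ} : σ ∈ T → Derives T Γ (named σ)
  | imp_intro {Γ φ ψ} : Derives T (φ :: Γ) ψ → Derives T Γ (φ.imp ψ)
  | imp_elim {Γ φ ψ} : Derives T Γ (φ.imp ψ) → Derives T Γ φ → Derives T Γ ψ
  | by_contra {Γ φ} : Derives T (φ.not :: Γ) ⊥ → Derives T Γ φ
  | all_intro {Γ} {ψ : BFml ℕ 1} :
      Derives T (Γ.map fun φ => app φ fun k => fv (k + 1))
        (ren (Sum.elim (fun k => fv (k + 1)) fun _ => fv 0) ψ) →
      Derives T Γ ψ.all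
  | all_elim {Γ} {ψ : BFml ℕ 1} (k : ℕ) : Derives T Γ ψ.all →
      Derives T Γ (ren (Sum.elim fv fun _ => fv k) ψ)
  | eq_refl {Γ} (k : ℕ) : Derives T Γ (fv k ≐ fv k)
  | eq_subst {Γ} (ψ : BFml ℕ 1) (j k : ℕ) : Derives T Γ (fv j ≐ fv k) →
      Derives T Γ (ren (Sum.elim fv fun _ => fv j) ψ) →
      Derives T Γ (ren (Sum.elim fv fun _ => fv k) ψ)

/-- `φ ⊢_T ψ`. -/
def Entails {α : Type} [Encodable α] (T : LSet.Theory) (φ ψ : Fml α) : Prop :=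
  Derives T [named φ] (named ψ)

/-- `⊢_T φ`. -/
def Provable {α : Type} [Encodable α] (T : LSet.Theory) (φ : Fml α) : Prop :=
  Derives T [] (named φ)

/-! ### Renaming lemmas -/

theorem up_comp {α β γ : Type} {n m k : ℕ} (ρ : α ⊕ Fin n → β ⊕ Fin m)
    (τ : β ⊕ Fin m → γ ⊕ Fin k) : up τ ∘ up ρ = up (τ ∘ ρ) := by
  funext x
  rcases x with a | i
  · simp only [up, Function.comp, Sum.elim_inl]
    rcases ρ (Sum.inl a) with b | j <;> simp
  · refine Fin.lastCases ?_ (fun i => ?_) i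
    · simp [up]
    · simp only [up, Function.comp, Sum.elim_inr, Fin.lastCases_castSucc]
      rcases ρ (Sum.inr i) with b | j <;> simp

theorem up_id {α : Type} {n : ℕ} : up (id : α ⊕ Fin n → α ⊕ Fin n) = id := by
  funext x
  rcases x with a | i
  · simp [up]
  · refine Fin.lastCases ?_ (fun i => ?_) i <;> simp [up]

theorem ren_ren {α β γ : Type} {n m k : ℕ} (ρ : α ⊕ Fin n → β ⊕ Fin m)
    (τ : β ⊕ Fin m → γ ⊕ Fin k) (φ : BFml α n) : ren τ (ren ρ φ) = ren (τ ∘ ρ) φ := by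
  induction φ generalizing m k with
  | falsum => rfl
  | equal t s => simp [ren]
  | rel R ts => simp [ren]
  | imp φ ψ h1 h2 => simp [ren, h1, h2]
  | all φ h => simp [ren, h, up_comp]

theorem ren_id {α : Type} {n : ℕ} (φ : BFml α n) : ren id φ = φ := by
  induction φ with
  | falsum => rfl
  | equal t s => simp [ren]
  | rel R ts => simp [ren]
  | imp φ ψ h1 h2 => simp [ren, h1, h2]
  | all φ h => simp [ren, h, up_id]

theorem ren_bound {n : ℕ} (φ : BFml ℕ n) : ∃ N : ℕ, ∀ {β : Type} {m : ℕ}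
    (ρ τ : ℕ ⊕ Fin n → β ⊕ Fin m), (∀ k < N, ρ (fv k) = τ (fv k)) →
      (∀ i, ρ (bv i) = τ (bv i)) → ren ρ φ = ren τ φ := by
  have term : ∀ {n : ℕ} (t : LSet.Term (ℕ ⊕ Fin n)), ∃ N : ℕ, ∀ {β : Type} {m : ℕ}
      (ρ τ : ℕ ⊕ Fin n → β ⊕ Fin m), (∀ k < N, ρ (fv k) = τ (fv k)) →
      (∀ i, ρ (bv i) = τ (bv i)) → t.relabel ρ = t.relabel τ := by
    intro n t
    rcases t with x | ⟨f, _⟩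
    · rcases x with k | i
      · exact ⟨k + 1, fun ρ τ h _ => by simp [h k (Nat.lt_succ_self k)]⟩
      · exact ⟨0, fun ρ τ _ h => by simp [h i]⟩
    · exact f.elim
  induction φ with
  | falsum => exact ⟨0, fun _ _ _ _ => rfl⟩
  | equal t s =>
    obtain ⟨N, hN⟩ := term t
    obtain ⟨K, hK⟩ := term s
    refine ⟨max N K, fun ρ τ h h' => ?_⟩
    simp only [ren]
    rw [hN ρ τ (fun k hk => h k (lt_max_of_lt_left hk)) h',
      hK ρ τ (fun k hk => h k (lt_max_of_lt_right hk)) h']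
  | rel R ts =>
    choose N hN using fun i => term (ts i)
    refine ⟨Finset.univ.sup N, fun ρ τ h h' => ?_⟩
    simp only [ren]
    congr 1
    funext i
    exact hN i ρ τ (fun k hk => h k (hk.trans_le (Finset.le_sup (Finset.mem_univ i)))) h'
  | imp φ ψ h1 h2 =>
    obtain ⟨N, hN⟩ := h1
    obtain ⟨K, hK⟩ := h2
    refine ⟨max N K, fun ρ τ h h' => ?_⟩
    simp only [ren]
    rw [hN ρ τ (fun k hk => h k (lt_max_of_lt_left hk)) h',
      hK ρ τ (fun k hk => h k (lt_max_of_lt_right hk)) h']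
  | all φ h =>
    obtain ⟨N, hN⟩ := h
    refine ⟨N, fun ρ τ h h' => ?_⟩
    simp only [ren]
    rw [hN (up ρ) (up τ) (fun k hk => by simp only [up, Sum.elim_inl]; rw [h k hk])]
    intro i
    refine Fin.lastCases ?_ (fun i => ?_) i
    · simp [up]
    · simp only [up, Sum.elim_inr, Fin.lastCases_castSucc]; rw [h' i]

/-! ### Semantics and soundness -/

theorem realize_ren {α β M : Type} [LSet.Structure M] {n m : ℕ} (ρ : α ⊕ Fin n → β ⊕ Fin m)
    (φ : BFml α n) (v : β → M) (xs : Fin m → M) :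
    (ren ρ φ).Realize v xs ↔
      φ.Realize (fun a => Sum.elim v xs (ρ (Sum.inl a))) fun i => Sum.elim v xs (ρ (Sum.inr i)) := by
  have key : ∀ {n m : ℕ} (ρ : α ⊕ Fin n → β ⊕ Fin m) (xs : Fin m → M),
      Sum.elim (fun a => Sum.elim v xs (ρ (Sum.inl a))) (fun i => Sum.elim v xs (ρ (Sum.inr i))) =
        Sum.elim v xs ∘ ρ := by
    intro n m ρ xs
    funext x
    rcases x with a | i <;> rfl
  induction φ generalizing m with
  | falsum => rfl
  | equal t s => simp only [ren, BoundedFormula.Realize, Term.realize_relabel, key]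
  | rel R ts => simp only [ren, BoundedFormula.Realize, Term.realize_relabel, key]
  | imp φ ψ h1 h2 => simp only [ren, BoundedFormula.Realize, h1, h2]
  | all φ h =>
    simp only [ren, BoundedFormula.Realize, h]
    refine forall_congr' fun a => ?_
    have e : ∀ y : β ⊕ Fin m, Sum.elim v (Fin.snoc xs a : Fin (m + 1) → M)
        (Sum.map id Fin.castSucc y) = Sum.elim v xs y := by
      intro y
      rcases y with b | j <;> simp
    have h1 : (fun b => Sum.elim v (Fin.snoc xs a : Fin (m + 1) → M) (up ρ (Sum.inl b))) =
        fun b => Sum.elim v xs (ρ (Sum.inl b)) := by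
      funext b
      simp only [up, Sum.elim_inl, e]
    have h2 : (fun i => Sum.elim v (Fin.snoc xs a : Fin (m + 1) → M) (up ρ (Sum.inr i))) =
        Fin.snoc (fun i => Sum.elim v xs (ρ (Sum.inr i))) a := by
      funext i
      refine Fin.lastCases ?_ (fun i => ?_) i
      · simp [up]
      · simp only [up, Sum.elim_inr, Fin.lastCases_castSucc, e, Fin.snoc_castSucc]
    rw [h1, h2]

theorem realize_app {α β M : Type} [LSet.Structure M] {m : ℕ} (φ : Fml α) (f : α → β ⊕ Fin m)
    (v : β → M) (xs : Fin m → M) :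
    (app φ f).Realize v xs ↔ Formula.Realize φ fun a => Sum.elim v xs (f a) := by
  rw [app, realize_ren, Formula.Realize]
  simp only [Sum.elim_inl]
  rw [Subsingleton.elim (fun i : Fin 0 => _) (default : Fin 0 → M)]

theorem realize_all' {α M : Type} [LSet.Structure M] (ψ : BFml α 1) (v : α → M)
    (xs : Fin 0 → M) :
    BoundedFormula.Realize (BoundedFormula.all ψ) v xs ↔ ∀ a, ψ.Realize v fun _ => a := by
  simp only [BoundedFormula.Realize]
  refine forall_congr' fun a => ?_
  have : (Fin.snoc xs a : Fin 1 → M) = fun _ => a := by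
    funext i
    obtain rfl : i = Fin.last 0 := Subsingleton.elim (α := Fin 1) _ _
    exact Fin.snoc_last (α := fun _ => M) a xs
  rw [this]

theorem Derives.sound {T : LSet.Theory} {Γ : List (Fml ℕ)} {φ : Fml ℕ} (h : Derives T Γ φ)
    (M : Type) [LSet.Structure M] [hT : M ⊨ T] (v : ℕ → M) (hΓ : ∀ ψ ∈ Γ, Formula.Realize ψ v) :
    Formula.Realize φ v := by
  induction h generalizing v with
  | hyp h => exact hΓ _ h
  | ax h =>
    rw [named, Formula.Realize, realize_app, Subsingleton.elim (fun a => _) (default : Empty → M)]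
    exact hT.realize_of_mem _ h
  | imp_intro _ ih =>
    intro h
    exact ih v (by simpa using ⟨h, hΓ⟩)
  | imp_elim _ _ ih1 ih2 => exact ih1 v hΓ (ih2 v hΓ)
  | by_contra _ ih =>
    by_contra hn
    refine ih v ?_
    simp only [List.mem_cons, forall_eq_or_imp]
    exact ⟨hn, hΓ⟩
  | all_intro _ ih =>
    rw [Formula.Realize, realize_all']
    intro a
    have := ih (fun k => Nat.casesOn k a v) (by
      intro ψ hψ
      obtain ⟨χ, hχ, rfl⟩ := List.mem_map.1 hψ
      rw [Formula.Realize, realize_app]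
      exact hΓ χ hχ)
    rw [Formula.Realize, realize_ren] at this
    exact this
  | all_elim k _ ih =>
    have := ih v hΓ
    rw [Formula.Realize, realize_all'] at this
    rw [Formula.Realize, realize_ren]
    exact this (v k)
  | eq_refl k => rfl
  | eq_subst ψ j k _ _ ih1 ih2 =>
    have h1 : v j = v k := ih1 v hΓ
    have h2 := ih2 v hΓ
    rw [Formula.Realize, realize_ren] at h2 ⊢
    simp only [Sum.elim_inl, Sum.elim_inr] at h2 ⊢
    rwa [← h1]

/-! ### Completeness of natural deduction -/

namespace Derives

variable {T : LSet.Theory} {Γ Δ : List (Fml ℕ)} {φ ψ : Fml ℕ}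

theorem weaken (h : Derives T Γ φ) (hs : Γ ⊆ Δ) : Derives T Δ φ := by
  induction h generalizing Δ with
  | hyp h => exact hyp (hs h)
  | ax h => exact ax h
  | imp_intro _ ih => exact imp_intro (ih (List.cons_subset_cons _ hs))
  | imp_elim _ _ ih1 ih2 => exact imp_elim (ih1 hs) (ih2 hs)
  | by_contra _ ih => exact by_contra (ih (List.cons_subset_cons _ hs))
  | all_intro _ ih => exact all_intro (ih (List.map_subset _ hs))
  | all_elim k _ ih => exact all_elim k (ih hs)
  | eq_refl k => exact eq_refl k
  | eq_subst ψ j k _ _ ih1 ih2 => exact eq_subst ψ j k (ih1 hs) (ih2 hs)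

theorem rename (h : Derives T Γ φ) (f : ℕ → ℕ) :
    Derives T (Γ.map fun φ => app φ fun k => fv (f k)) (app φ fun k => fv (f k)) := by
  induction h generalizing f with
  | hyp h => exact hyp (List.mem_map_of_mem h)
  | @ax Γ σ h =>
    have e : app (named σ) (fun k => fv (n := 0) (f k)) = named σ := by
      simp only [named, app, ren_ren]
      congr 1
      funext x
      rcases x with x | x
      · exact x.elim
      · exact x.elim0
    rw [e]
    exact ax h
  | imp_intro _ ih => exact imp_intro (ih f)
  | imp_elim _ _ ih1 ih2 => exact imp_elim (ih1 f) (ih2 f)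
  | by_contra _ ih => exact by_contra (ih f)
  | @all_intro Γ ψ _ ih =>
    have h := ih fun k => Nat.casesOn k 0 fun k => f k + 1
    refine all_intro ?_
    convert h using 1
    · simp only [List.map_map]
      congr 1
      funext φ
      simp only [Function.comp, app, ren_ren]
      congr 1
      funext x
      rcases x with x | x
      · rfl
      · exact x.elim0
    · simp only [app, ren_ren]
      congr 1
      funext x
      rcases x with x | x
      · rfl
      · obtain rfl : x = Fin.last 0 := Subsingleton.elim (α := Fin 1) _ _
        simp only [up, Function.comp, Sum.elim_inr, Fin.lastCases_last]
        rfl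
  | @all_elim Γ ψ k _ ih =>
    convert all_elim (f k) (ih f) using 1
    simp only [app, ren_ren]
    congr 1
    funext x
    rcases x with x | x
    · rfl
    · obtain rfl : x = Fin.last 0 := Subsingleton.elim (α := Fin 1) _ _
      simp only [up, Function.comp, Sum.elim_inr, Fin.lastCases_last]
      rfl
  | eq_refl k => exact eq_refl (f k)
  | @eq_subst Γ ψ j k _ _ ih1 ih2 =>
    have e : ∀ i : ℕ, (app (ren (Sum.elim fv fun _ => fv i) ψ) (fun k => fv (f k)) : Fml ℕ) =
        ren (Sum.elim fv fun _ => fv (f i))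
          (ren (up (Sum.elim (fun k => fv (f k)) Fin.elim0 : ℕ ⊕ Fin 0 → ℕ ⊕ Fin 0)) ψ) := by
      intro i
      simp only [app, ren_ren]
      congr 1
      funext x
      rcases x with x | x
      · rfl
      · obtain rfl : x = Fin.last 0 := Subsingleton.elim (α := Fin 1) _ _
        simp only [up, Function.comp, Sum.elim_inr, Fin.lastCases_last]
        rfl
    have h2 := ih2 f
    rw [e] at h2 ⊢
    exact eq_subst _ (f j) (f k) (ih1 f) h2

theorem cut (h : Derives T (φ :: Γ) ψ) (h' : Derives T Γ φ) : Derives T Γ ψ :=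
  imp_elim (imp_intro h) h'

theorem exfalso (h : Derives T Γ ⊥) : Derives T Γ φ :=
  by_contra (h.weaken (List.subset_cons_self _ _))

theorem eq_symm {j k : ℕ} (h : Derives T Γ (fv j ≐ fv k)) : Derives T Γ (fv k ≐ fv j) :=
  eq_subst (bv 0 ≐ fv j) j k h (eq_refl j)

theorem eq_trans {i j k : ℕ} (h : Derives T Γ (fv i ≐ fv j)) (h' : Derives T Γ (fv j ≐ fv k)) :
    Derives T Γ (fv i ≐ fv k) :=
  eq_subst (fv i ≐ bv 0) j k h' h

theorem mem_congr {i i' j j' : ℕ} (h : Derives T Γ (fv i ≐ fv i')) (h' : Derives T Γ (fv j ≐ fv j'))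
    (hm : Derives T Γ (fv i ∈' fv j)) : Derives T Γ (fv i' ∈' fv j') := by
  have e : ∀ a b c : ℕ, (ren (Sum.elim fv fun _ => fv c) (fv a ∈' bv 0 : BFml ℕ 1) : Fml ℕ) =
      fv a ∈' fv c := by
    intro a b c
    simp only [memF, ren]
    congr 1
    funext i
    fin_cases i <;> rfl
  have e' : ∀ b c : ℕ, (ren (Sum.elim fv fun _ => fv c) (bv 0 ∈' fv b : BFml ℕ 1) : Fml ℕ) =
      fv c ∈' fv b := by
    intro b c
    simp only [memF, ren]
    congr 1
    funext i
    fin_cases i <;> rfl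
  have h1 : Derives T Γ (fv i' ∈' fv j) := by
    rw [← e']
    refine eq_subst _ i i' h ?_
    rwa [e']
  rw [← e i' 0]
  refine eq_subst _ j j' h' ?_
  rwa [e i' 0]

/-- Generalization on a variable that does not occur. -/
theorem exists_fresh (Γ : List (Fml ℕ)) (ψ : BFml ℕ 1) : ∃ c : ℕ, ∀ T,
    Derives T Γ (ren (Sum.elim fv fun _ => fv c) ψ) → Derives T Γ ψ.all := by
  have hb : ∃ N : ℕ, ∀ φ ∈ Γ, ∀ ρ τ : ℕ ⊕ Fin 0 → ℕ ⊕ Fin 0,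
      (∀ k < N, ρ (fv k) = τ (fv k)) → ren ρ φ = ren τ φ := by
    induction Γ with
    | nil => exact ⟨0, by simp⟩
    | cons φ Γ ih =>
      obtain ⟨N, hN⟩ := ih
      obtain ⟨K, hK⟩ := ren_bound φ
      refine ⟨max N K, fun χ hχ ρ τ h => ?_⟩
      rcases List.mem_cons.1 hχ with rfl | hχ
      · exact hK ρ τ (fun k hk => h k (lt_max_of_lt_right hk)) fun i => i.elim0
      · exact hN χ hχ ρ τ fun k hk => h k (lt_max_of_lt_left hk)
  obtain ⟨N, hN⟩ := hb
  obtain ⟨K, hK⟩ := ren_bound ψ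
  refine ⟨max N K, fun T h => all_intro ?_⟩
  have h' := h.rename fun k => if k = max N K then 0 else k + 1
  convert h' using 1
  · refine List.map_congr_left fun φ hφ => hN φ hφ _ _ fun k hk => ?_
    have : k ≠ max N K := (lt_max_of_lt_left hk).ne
    simp only [Sum.elim_inl, if_neg this]
  · simp only [app, ren_ren]
    refine hK _ _ (fun k hk => ?_) fun i => ?_
    · have : k ≠ max N K := (lt_max_of_lt_right hk).ne
      simp only [Function.comp, Sum.elim_inl, if_neg this]
    · simp

end Derives

/-- Consistency of a finite list of assumptions. -/
def Con (T : LSet.Theory) (Γ : List (Fml ℕ)) : Prop := ¬ Derives T Γ ⊥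

theorem con_cases {T : LSet.Theory} {Γ : List (Fml ℕ)} (h : Con T Γ) (φ : Fml ℕ) :
    Con T (φ :: Γ) ∨ Con T (φ.not :: Γ) := by
  by_contra hn
  simp only [Con, not_or, not_not] at hn
  exact h (Derives.cut hn.1 (.by_contra hn.2))

theorem con_henkin {T : LSet.Theory} {Γ : List (Fml ℕ)} (h : Con T Γ) (ψ : BFml ℕ 1) :
    ∃ c : ℕ, Con T (BoundedFormula.imp (ren (Sum.elim fv fun _ => fv c) ψ) ψ.all :: Γ) := by
  obtain ⟨c, hc⟩ := Derives.exists_fresh Γ ψ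
  refine ⟨c, fun hd => h ?_⟩
  have hn : ∀ {χ : Fml ℕ}, Derives T (χ :: Γ) ⊥ → Derives T Γ χ.not := fun h => .imp_intro h
  have h1 := hn hd
  have h2 : Derives T Γ (ren (Sum.elim fv fun _ => fv c) ψ) := by
    refine .by_contra (.imp_elim (h1.weaken (List.subset_cons_self _ _)) (.imp_intro ?_))
    refine Derives.exfalso (.imp_elim (φ := ren (Sum.elim fv fun _ => fv c) ψ)
      (.hyp ?_) (.hyp ?_))
    · exact List.mem_cons_of_mem _ List.mem_cons_self
    · exact List.mem_cons_self
  exact .imp_elim h1 (.imp_intro ((hc T h2).weaken (List.subset_cons_self _ _)))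

instance : Countable LSet.Symbols := by
  have : ∀ n, Countable (MemSymbol n) := fun n =>
    ⟨⟨fun _ => 0, fun a b _ => by cases a; cases b; rfl⟩⟩
  have h1 : Countable (Σ n, LSet.Functions n) := ⟨⟨fun x => x.2.elim, fun x => x.2.elim⟩⟩
  have h2 : Countable (Σ n, LSet.Relations n) := inferInstanceAs (Countable (Σ n, MemSymbol n))
  exact inferInstanceAs (Countable ((Σ n, LSet.Functions n) ⊕ (Σ n, LSet.Relations n)))

instance (n : ℕ) : Countable (BFml ℕ n) :=
  Function.Injective.countable (f := fun φ => (⟨n, φ⟩ : Σ n, BFml ℕ n)) fun _ _ h => by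
    simpa using h

/-- A consistent list extends to a maximal consistent set with Henkin witnesses. -/
theorem exists_maximal {T : LSet.Theory} {Γ : List (Fml ℕ)} (h : Con T Γ) :
    ∃ S : Set (Fml ℕ), (∀ φ ∈ Γ, φ ∈ S) ∧
      (∀ Δ : List (Fml ℕ), (∀ φ ∈ Δ, φ ∈ S) → Con T Δ) ∧ (∀ φ : Fml ℕ, φ ∈ S ∨ φ.not ∈ S) ∧
      ∀ ψ : BFml ℕ 1, ∃ c : ℕ,
        BoundedFormula.imp (ren (Sum.elim fv fun _ => fv c) ψ) ψ.all ∈ S := by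
  obtain ⟨e, he⟩ := exists_surjective_nat (Fml ℕ)
  have : Nonempty (BFml ℕ 1) := ⟨⊥⟩
  obtain ⟨e', he'⟩ := exists_surjective_nat (BFml ℕ 1)
  have step : ∀ (n : ℕ) (Γ : {Γ // Con T Γ}), ∃ Γ' : {Γ // Con T Γ}, Γ.1 ⊆ Γ'.1 ∧
      (e n ∈ Γ'.1 ∨ (e n).not ∈ Γ'.1) ∧
      ∃ c : ℕ, BoundedFormula.imp (ren (Sum.elim fv fun _ => fv c) (e' n)) (e' n).all ∈ Γ'.1 := by
    rintro n ⟨Γ, hΓ⟩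
    obtain ⟨c, hc⟩ := con_henkin hΓ (e' n)
    rcases con_cases hc (e n) with hd | hd
    · exact ⟨⟨_, hd⟩, fun _ hx => by simp [hx], Or.inl (by simp), c, by simp⟩
    · exact ⟨⟨_, hd⟩, fun _ hx => by simp [hx], Or.inr (by simp), c, by simp⟩
  choose s hs1 hs2 hs3 using step
  let G : ℕ → {Γ // Con T Γ} := fun n => Nat.rec ⟨Γ, h⟩ (fun n Γ => s n Γ) n
  have mono : ∀ {m n : ℕ}, m ≤ n → (G m).1 ⊆ (G n).1 := by
    intro m n hmn
    induction hmn with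
    | refl => exact List.Subset.refl _
    | step _ ih => exact List.Subset.trans ih (hs1 _ _)
  refine ⟨{φ | ∃ n, φ ∈ (G n).1}, fun φ hφ => ⟨0, hφ⟩, fun Δ hΔ => ?_, fun φ => ?_, fun ψ => ?_⟩
  · have : ∃ n, Δ ⊆ (G n).1 := by
      induction Δ with
      | nil => exact ⟨0, by simp⟩
      | cons φ Δ ih =>
        obtain ⟨n, hn⟩ := ih fun φ hφ => hΔ φ (by simp [hφ])
        obtain ⟨m, hm⟩ := hΔ φ (by simp)
        refine ⟨max n m, fun χ hχ => ?_⟩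
        rcases List.mem_cons.1 hχ with rfl | hχ
        · exact mono (le_max_right _ _) hm
        · exact mono (le_max_left _ _) (hn hχ)
    obtain ⟨n, hn⟩ := this
    exact fun hd => (G n).2 (hd.weaken hn)
  · obtain ⟨n, rfl⟩ := he φ
    rcases hs2 n (G n) with h | h
    · exact Or.inl ⟨n + 1, h⟩
    · exact Or.inr ⟨n + 1, h⟩
  · obtain ⟨n, rfl⟩ := he' ψ
    obtain ⟨c, hc⟩ := hs3 n (G n)
    exact ⟨c, n + 1, hc⟩

/-- Every consistent list of assumptions holds in some model of the theory. -/
theorem exists_model {T : LSet.Theory} {Γ : List (Fml ℕ)} (h : Con T Γ) :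
    ∃ (M : Type) (_ : LSet.Structure M) (v : ℕ → M), M ⊨ T ∧ ∀ φ ∈ Γ, Formula.Realize φ v := by
  obtain ⟨S, hΓ, hcon, hmax, hhen⟩ := exists_maximal h
  have closed : ∀ {Δ : List (Fml ℕ)} {φ : Fml ℕ}, (∀ χ ∈ Δ, χ ∈ S) → Derives T Δ φ → φ ∈ S := by
    intro Δ φ hΔ hd
    refine (hmax φ).resolve_right fun hn => ?_
    refine hcon (φ.not :: Δ) (by simpa using ⟨hn, hΔ⟩) ?_
    exact .imp_elim (.hyp (List.mem_cons_self)) (hd.weaken (List.subset_cons_self _ _))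
  have not_both : ∀ {φ : Fml ℕ}, φ ∈ S → φ.not ∉ S := by
    intro φ h1 h2
    refine hcon [φ, φ.not] (by simp [h1, h2]) ?_
    exact .imp_elim (.hyp (φ := φ.not) (by simp)) (.hyp (by simp))
  have nil : ∀ χ ∈ ([] : List (Fml ℕ)), χ ∈ S := by simp
  let r : Setoid ℕ :=
    { r := fun j k => (fv j ≐ fv k : Fml ℕ) ∈ S
      iseqv :=
        { refl := fun k => closed nil (.eq_refl k)
          symm := fun {j k} h => closed (Δ := [(fv j ≐ fv k : Fml ℕ)]) (by simpa using h)
            (Derives.eq_symm (.hyp (by simp)))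
          trans := fun {i j k} h h' =>
            closed (Δ := [(fv i ≐ fv j : Fml ℕ), (fv j ≐ fv k : Fml ℕ)]) (by simpa using ⟨h, h'⟩)
              (Derives.eq_trans (j := j) (.hyp (by simp)) (.hyp (by simp))) } }
  let E : Quotient r → Quotient r → Prop := Quotient.lift₂ (fun j k => (fv j ∈' fv k : Fml ℕ) ∈ S) (by
    have aux : ∀ a b a' b' : ℕ, (fv a ≐ fv a' : Fml ℕ) ∈ S → (fv b ≐ fv b' : Fml ℕ) ∈ S →
        (fv a ∈' fv b : Fml ℕ) ∈ S → (fv a' ∈' fv b' : Fml ℕ) ∈ S := fun a b a' b' h1 h2 h3 =>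
      closed (Δ := [(fv a ≐ fv a' : Fml ℕ), (fv b ≐ fv b' : Fml ℕ), (fv a ∈' fv b : Fml ℕ)])
        (by simpa using ⟨h1, h2, h3⟩)
        (Derives.mem_congr (i := a) (j := b) (.hyp (by simp)) (.hyp (by simp)) (.hyp (by simp)))
    exact fun a b a' b' h1 h2 =>
      propext ⟨aux _ _ _ _ h1 h2, aux _ _ _ _ (r.symm h1) (r.symm h2)⟩)
  let str : LSet.Structure (Quotient r) :=
    { funMap := fun f => f.elim
      RelMap := fun {n} R => match n, R with
        | _, .mem => fun xs => E (xs 0) (xs 1) }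
  let q : ℕ → Quotient r := fun k => ⟦k⟧
  have truth : ∀ {n : ℕ} (φ : BFml ℕ n) (xs : Fin n → ℕ),
      φ.Realize q (fun i => q (xs i)) ↔ (ren (Sum.elim fv fun i => fv (xs i)) φ : Fml ℕ) ∈ S := by
    have tm : ∀ {n : ℕ} (t : LSet.Term (ℕ ⊕ Fin n)) (xs : Fin n → ℕ), ∃ k : ℕ,
        t.realize (Sum.elim q fun i => q (xs i)) = q k ∧
          t.relabel (Sum.elim fv fun i => fv (xs i)) = (Term.var (fv k) : LSet.Term (ℕ ⊕ Fin 0)) := by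
      intro n t xs
      rcases t with x | ⟨f, _⟩
      · rcases x with k | i
        · exact ⟨k, rfl, rfl⟩
        · exact ⟨xs i, rfl, rfl⟩
      · exact f.elim
    intro n φ
    induction φ with
    | falsum =>
      intro xs
      exact ⟨False.elim, fun h => hcon [⊥] (fun χ hχ => by rw [List.mem_singleton.1 hχ]; exact h) (.hyp (by simp))⟩
    | equal t s =>
      intro xs
      obtain ⟨j, hj, hj'⟩ := tm t xs
      obtain ⟨k, hk, hk'⟩ := tm s xs
      simp only [BoundedFormula.Realize, ren, hj, hj', hk, hk']
      exact Quotient.eq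
    | rel R ts =>
      intro xs
      cases R
      obtain ⟨j, hj, hj'⟩ := tm (ts 0) xs
      obtain ⟨k, hk, hk'⟩ := tm (ts 1) xs
      have e : (ren (Sum.elim fv fun i => fv (xs i))
          (BoundedFormula.rel (L := LSet) MemSymbol.mem ts) : Fml ℕ) = fv j ∈' fv k := by
        simp only [ren, memF]
        congr 1
        funext i
        fin_cases i
        · exact hj'
        · exact hk'
      rw [e]
      change E ((ts 0).realize _) ((ts 1).realize _) ↔ _
      rw [hj, hk]
      rfl
    | imp φ ψ h1 h2 =>
      intro xs
      simp only [BoundedFormula.Realize, ren, h1, h2]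
      generalize (ren (Sum.elim fv fun i => fv (xs i)) φ : Fml ℕ) = a
      generalize (ren (Sum.elim fv fun i => fv (xs i)) ψ : Fml ℕ) = b
      constructor
      · intro h
        rcases hmax a with ha | ha
        · exact closed (Δ := [b]) (by simpa using h ha) (.imp_intro (.hyp (by simp)))
        · refine closed (Δ := [a.not]) (by simpa using ha) (.imp_intro (Derives.exfalso ?_))
          exact .imp_elim (.hyp (φ := a.not) (by simp)) (.hyp (by simp))
      · intro h ha
        exact closed (Δ := [a, a.imp b]) (by simpa using ⟨ha, h⟩)
          (.imp_elim (.hyp (φ := a.imp b) (by simp)) (.hyp (by simp)))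
    | @all n φ ih =>
      intro xs
      have e : ∀ k : ℕ, (ren (Sum.elim fv fun _ => fv k)
          (ren (up (Sum.elim fv fun i => fv (xs i))) φ : BFml ℕ 1) : Fml ℕ) =
          ren (Sum.elim fv fun i => fv ((Fin.snoc xs k : Fin (n + 1) → ℕ) i)) φ := by
        intro k
        rw [ren_ren]
        congr 1
        funext x
        rcases x with x | x
        · rfl
        · refine Fin.lastCases ?_ (fun i => ?_) x <;> simp [up]
      have e' : ∀ k : ℕ, (Fin.snoc (fun i => q (xs i)) (q k) : Fin (n + 1) → Quotient r) =
          fun i => q ((Fin.snoc xs k : Fin (n + 1) → ℕ) i) := by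
        intro k
        funext x
        refine Fin.lastCases ?_ (fun i => ?_) x <;> simp
      have h1 : BoundedFormula.Realize φ.all q (fun i => q (xs i)) ↔
          ∀ k : ℕ, (ren (Sum.elim fv fun i => fv ((Fin.snoc xs k : Fin (n + 1) → ℕ) i)) φ : Fml ℕ) ∈
            S := by
        simp only [← ih, ← e', BoundedFormula.Realize]
        exact ⟨fun h k => h _, fun h a => Quotient.inductionOn a h⟩
      rw [h1]
      simp only [ren, ← e]
      generalize (ren (up (Sum.elim fv fun i => fv (xs i))) φ : BFml ℕ 1) = χ
      constructor
      · intro h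
        obtain ⟨c, hc⟩ := hhen χ
        exact closed (Δ := [_, _]) (by simpa using ⟨h c, hc⟩)
          (.imp_elim (φ := ren (Sum.elim fv fun _ => fv c) χ) (.hyp (by simp)) (.hyp (by simp)))
      · intro h k
        exact closed (Δ := [χ.all]) (by simpa using h) (.all_elim k (.hyp (by simp)))
  have truth0 : ∀ φ : Fml ℕ, Formula.Realize φ q ↔ φ ∈ S := by
    intro φ
    have h := truth φ Fin.elim0
    have e : (Sum.elim fv fun i => fv (Fin.elim0 i) : ℕ ⊕ Fin 0 → ℕ ⊕ Fin 0) = id := by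
      funext x
      rcases x with x | x
      · rfl
      · exact x.elim0
    rw [e, ren_id] at h
    rw [← h, Formula.Realize]
    exact iff_of_eq (congrArg _ (Subsingleton.elim _ _))
  refine ⟨Quotient r, str, q, ⟨fun σ hσ => ?_⟩, fun φ hφ => (truth0 φ).2 (hΓ φ hφ)⟩
  have := (truth0 (named σ)).2 (closed nil (.ax hσ))
  rw [named, Formula.Realize, realize_app] at this
  rw [Sentence.Realize]
  convert this

theorem entails_iff {α : Type} [Encodable α] {T : LSet.Theory} {φ ψ : Fml α} :
    Entails T φ ψ ↔ ∀ (M : Type) [Nonempty M] [LSet.Structure M] [M ⊨ T] (v : α → M),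
      Formula.Realize φ v → Formula.Realize ψ v := by
  have hnamed : ∀ {M : Type} [LSet.Structure M] (φ : Fml α) (v : ℕ → M),
      Formula.Realize (named φ) v ↔ Formula.Realize φ fun a => v (Encodable.encode a) := by
    intro M _ φ v
    rw [named, Formula.Realize, realize_app]
    rfl
  constructor
  · intro h M hM _ _ v hφ
    obtain ⟨m⟩ := hM
    let w : ℕ → M := fun k => ((Encodable.decode (α := α) k).map v).getD m
    have hw : (fun a => w (Encodable.encode a)) = v := by
      funext a
      simp [w]
    have := Derives.sound h M w (by simpa [hnamed, hw] using hφ)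
    rwa [hnamed, hw] at this
  · intro h
    by_contra hn
    have hc : Con T [(named ψ).not, named φ] := fun hd => hn (.by_contra hd)
    obtain ⟨M, _, v, _, hv⟩ := exists_model hc
    have h1 := hv (named φ) (by simp)
    have h2 := hv (named ψ).not (by simp)
    have : Nonempty M := ⟨v 0⟩
    exact h2 ((hnamed ψ v).2 (h M _ ((hnamed φ v).1 h1)))

theorem provable_iff {α : Type} [Encodable α] {T : LSet.Theory} {φ : Fml α} :
    Provable T φ ↔ ∀ (M : Type) [Nonempty M] [LSet.Structure M] [M ⊨ T] (v : α → M),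
      Formula.Realize φ v := by
  have h : Provable T φ ↔ Entails T ⊤ φ :=
    ⟨fun h => Derives.weaken h (List.nil_subset _),
      fun h => .imp_elim (.imp_intro h) (.imp_intro (.hyp (φ := ⊥) List.mem_cons_self))⟩
  rw [h, entails_iff]
  simp

/-! ### Zermelo–Fraenkel set theory -/

/-- `x₀ ⊆ x₁`. -/
def subsetF : Fml (Fin 2) := ∀' ((bv 0 ∈' fv 0) ⟹ (bv 0 ∈' fv 1))

/-- `x₀ = 0`. -/
def emptyF : Fml (Fin 1) := ∀' ∼(bv 0 ∈' fv 0)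

/-- `x₀ = x₁ ∪ {x₁}`. -/
def succF : Fml (Fin 2) := ∀' ((bv 0 ∈' fv 0) ⇔ ((bv 0 ∈' fv 1) ⊔ (bv 0 ≐ fv 1)))

/-- Extensionality. -/
def extAx : LSet.Sentence :=
  ∀' ∀' ((∀' ((bv 2 ∈' bv 0) ⇔ (bv 2 ∈' bv 1))) ⟹ (bv 0 ≐ bv 1))

/-- The universal closure of a formula. -/
def close {k : ℕ} (φ : Fml (Fin k)) : LSet.Sentence :=
  (ren (Sum.elim bv Fin.elim0) φ : BFml Empty k).alls

/-- Separation for a formula `P` with parameters and a distinguished variable. -/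
def sepAx (k : ℕ) (P : Fml (Fin k ⊕ Fin 1)) : LSet.Sentence :=
  close (∀' ∃' ∀' ((bv 2 ∈' bv 1) ⇔ ((bv 2 ∈' bv 0) ⊓ app P (Sum.elim fv ![bv 2]))))

/-- Pairing. -/
def pairAx : LSet.Sentence :=
  ∀' ∀' ∃' ∀' ((bv 3 ∈' bv 2) ⇔ ((bv 3 ≐ bv 0) ⊔ (bv 3 ≐ bv 1)))

/-- Union. -/
def unionAx : LSet.Sentence :=
  ∀' ∃' ∀' ((bv 2 ∈' bv 1) ⇔ ∃' ((bv 2 ∈' bv 3) ⊓ (bv 3 ∈' bv 0)))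

/-- Power set. -/
def powerAx : LSet.Sentence :=
  ∀' ∃' ∀' ((bv 2 ∈' bv 1) ⇔ app subsetF ![bv 2, bv 0])

/-- Replacement for a formula `F` with parameters and two distinguished variables:
`∀ z (∀ x (x ∈ z → ∃! y F) → ∃ z' ∀ x (x ∈ z → ∃ y (y ∈ z' ∧ F)))`. -/
def replAx (k : ℕ) (F : Fml (Fin k ⊕ Fin 2)) : LSet.Sentence :=
  close (∀' ((∀' ((bv 1 ∈' bv 0) ⟹
      ∃' (app F (Sum.elim fv ![bv 1, bv 2]) ⊓
        ∀' (app F (Sum.elim fv ![bv 1, bv 3]) ⟹ (bv 3 ≐ bv 2))))) ⟹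
    ∃' ∀' ((bv 2 ∈' bv 0) ⟹ ∃' ((bv 3 ∈' bv 1) ⊓ app F (Sum.elim fv ![bv 2, bv 3])))))

/-- Infinity. -/
def infAx : LSet.Sentence :=
  ∃' ((∃' (app emptyF ![bv 1] ⊓ (bv 1 ∈' bv 0))) ⊓
    ∀' ((bv 1 ∈' bv 0) ⟹ ∃' (app succF ![bv 2, bv 1] ⊓ (bv 2 ∈' bv 0))))

/-- Foundation. -/
def foundAx : LSet.Sentence :=
  ∀' (∼(app emptyF ![bv 0]) ⟹
    ∃' ((bv 1 ∈' bv 0) ⊓ ∀' ((bv 2 ∈' bv 0) ⟹ ∼(bv 2 ∈' bv 1))))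

/-- The axioms of Zermelo–Fraenkel set theory. -/
inductive IsZFAxiom : LSet.Sentence → Prop
  | extensionality : IsZFAxiom extAx
  | separation (k : ℕ) (P : Fml (Fin k ⊕ Fin 1)) : IsZFAxiom (sepAx k P)
  | pairing : IsZFAxiom pairAx
  | union : IsZFAxiom unionAx
  | power : IsZFAxiom powerAx
  | replacement (k : ℕ) (F : Fml (Fin k ⊕ Fin 2)) : IsZFAxiom (replAx k F)
  | infinity : IsZFAxiom infAx
  | foundation : IsZFAxiom foundAx

/-- The theory ZF. -/
def ZF : LSet.Theory := {σ | IsZFAxiom σ}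

/-! ### The syntactic category of ZF -/

/-- A formula in context `{x₁, …, xₙ | P}`; the variables of the context are the elements of
`Fin n`. -/
structure ZFCat where
  arity : ℕ
  formula : Fml (Fin arity)

/-- `∃ y F`, for a list `y` of variables. -/
def exF {α : Type} {m : ℕ} (F : Fml (α ⊕ Fin m)) : Fml α :=
  BoundedFormula.exs (app F (Sum.elim fv bv))

/-- `{x, y | F}` represents an arrow from `{x | P}` to `{y | Q}`. -/
structure IsArrow (A B : ZFCat) (F : Fml (Fin A.arity ⊕ Fin B.arity)) : Prop where
  entails_left : Entails ZF F (app A.formula fun i => fv (.inl i))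
  entails_right : Entails ZF F (app B.formula fun j => fv (.inr j))
  single_valued : ∀ j, Entails (α := (Fin A.arity ⊕ Fin B.arity) ⊕ Fin B.arity) ZF
    (app F (fun a => fv (.inl a)) ⊓
      app F (Sum.elim (fun i => fv (.inl (.inl i))) fun j => fv (.inr j)))
    (fv (.inl (.inr j)) ≐ fv (.inr j))
  total : Entails ZF A.formula (exF F)

/-- Provable equivalence. -/
def arrowSetoid (A B : ZFCat) : Setoid {F // IsArrow A B F} where
  r F G := Provable ZF (F.1.iff G.1)
  iseqv := by
    simp only [provable_iff, Formula.realize_iff]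
    exact ⟨fun _ _ _ _ _ _ => Iff.rfl, fun h M _ _ _ v => (h M v).symm,
      fun h h' M _ _ _ v => (h M v).trans (h' M v)⟩

/-- Arrows of the syntactic category: formulas up to provable equivalence. -/
def Arrow (A B : ZFCat) : Type := Quotient (arrowSetoid A B)

/-- The arrow represented by a formula. -/
def Arrow.mk {A B : ZFCat} (F : Fml (Fin A.arity ⊕ Fin B.arity)) (h : IsArrow A B F) : Arrow A B :=
  Quotient.mk _ ⟨F, h⟩

/-- The formula `x = y ∧ P(x)`. -/
def idF (A : ZFCat) : Fml (Fin A.arity ⊕ Fin A.arity) :=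
  app A.formula (fun i => fv (.inl i)) ⊓
    ((List.finRange A.arity).map fun i => (fv (.inl i) ≐ fv (.inr i) : Fml _)).foldr (· ⊓ ·) ⊤

/-- The formula `∃ y (F(x, y) ∧ G(y, z))`. -/
def compF {A B C : ZFCat} (F : Fml (Fin A.arity ⊕ Fin B.arity))
    (G : Fml (Fin B.arity ⊕ Fin C.arity)) : Fml (Fin A.arity ⊕ Fin C.arity) :=
  exF (m := B.arity) (app F (Sum.elim (fun i => fv (.inl (.inl i))) fun j => fv (.inr j)) ⊓
    app G (Sum.elim (fun j => fv (.inr j)) fun k => fv (.inl (.inr k))))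

section Realize

variable {M : Type} [LSet.Structure M] {α : Type} {n : ℕ}

/-- Membership in a structure. -/
def E (x y : M) : Prop := Structure.RelMap (L := LSet) MemSymbol.mem ![x, y]

theorem realize_memF (u v : α ⊕ Fin n) (w : α → M) (xs : Fin n → M) :
    (u ∈' v).Realize w xs ↔ E (Sum.elim w xs u) (Sum.elim w xs v) := by
  simp only [memF, BoundedFormula.Realize, E]
  refine iff_of_eq (congrArg _ ?_)
  funext i
  fin_cases i <;> rfl

theorem realize_eqF (u v : α ⊕ Fin n) (w : α → M) (xs : Fin n → M) :
    (u ≐ v).Realize w xs ↔ Sum.elim w xs u = Sum.elim w xs v := Iff.rfl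

theorem realize_exF {m : ℕ} (F : Fml (α ⊕ Fin m)) (v : α → M) :
    Formula.Realize (exF F) v ↔ ∃ y : Fin m → M, Formula.Realize F (Sum.elim v y) := by
  rw [exF, BoundedFormula.realize_exs]
  refine exists_congr fun y => ?_
  rw [realize_app]
  refine iff_of_eq (congrArg _ ?_)
  funext a
  rcases a with a | a <;> rfl

theorem realize_app0 {β : Type} (φ : Fml α) (f : α → β ⊕ Fin 0) (v : β → M) :
    Formula.Realize (app φ f) v ↔ Formula.Realize φ fun a => Sum.elim v default (f a) :=
  realize_app φ f v default

theorem realize_close {k : ℕ} (φ : Fml (Fin k)) :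
    M ⊨ close φ ↔ ∀ v : Fin k → M, Formula.Realize φ v := by
  rw [close, Sentence.Realize, BoundedFormula.realize_alls]
  refine forall_congr' fun v => ?_
  rw [realize_ren, Formula.Realize]
  refine iff_of_eq (congrArg _ (Subsingleton.elim _ _))

theorem realize_idF (A : ZFCat) (v : Fin A.arity ⊕ Fin A.arity → M) :
    Formula.Realize (idF A) v ↔
      Formula.Realize A.formula (fun i => v (.inl i)) ∧ ∀ i, v (.inl i) = v (.inr i) := by
  rw [idF, Formula.realize_inf, realize_app0]
  refine and_congr Iff.rfl ?_
  rw [Formula.Realize, BoundedFormula.realize_foldr_inf]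
  simp [realize_eqF]

theorem realize_compF {A B C : ZFCat} (F : Fml (Fin A.arity ⊕ Fin B.arity))
    (G : Fml (Fin B.arity ⊕ Fin C.arity)) (v : Fin A.arity ⊕ Fin C.arity → M) :
    Formula.Realize (compF F G) v ↔ ∃ y : Fin B.arity → M,
      Formula.Realize F (Sum.elim (fun i => v (.inl i)) y) ∧
      Formula.Realize G (Sum.elim y fun k => v (.inr k)) := by
  rw [compF, realize_exF]
  refine exists_congr fun y => ?_
  rw [Formula.realize_inf, realize_app0, realize_app0]
  refine iff_of_eq (congrArg₂ And (congrArg _ ?_) (congrArg _ ?_)) <;>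
  · funext a
    rcases a with a | a <;> rfl

end Realize

theorem isArrow_iff {A B : ZFCat} {F : Fml (Fin A.arity ⊕ Fin B.arity)} :
    IsArrow A B F ↔ ∀ (M : Type) [Nonempty M] [LSet.Structure M] [M ⊨ ZF],
      (∀ (x : Fin A.arity → M) (y : Fin B.arity → M), Formula.Realize F (Sum.elim x y) →
        Formula.Realize A.formula x ∧ Formula.Realize B.formula y) ∧
      (∀ (x : Fin A.arity → M) (y y' : Fin B.arity → M), Formula.Realize F (Sum.elim x y) →
        Formula.Realize F (Sum.elim x y') → y = y') ∧
      ∀ x : Fin A.arity → M, Formula.Realize A.formula x →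
        ∃ y : Fin B.arity → M, Formula.Realize F (Sum.elim x y) := by
  constructor
  · rintro ⟨h1, h2, h3, h4⟩ M _ _ _
    rw [entails_iff] at h1 h2 h4
    refine ⟨fun x y h => ⟨?_, ?_⟩, fun x y y' h h' => funext fun j => ?_, fun x hx => ?_⟩
    · exact (realize_app0 _ _ _).1 (h1 M _ h)
    · exact (realize_app0 _ _ _).1 (h2 M _ h)
    · have := entails_iff.1 (h3 j) M (Sum.elim (Sum.elim x y) y')
      rw [Formula.realize_inf, realize_app0, realize_app0] at this
      refine this ⟨h, ?_⟩
      convert h' using 1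
      funext a
      rcases a with a | a <;> rfl
    · exact (realize_exF _ _).1 (h4 M x hx)
  · intro h
    refine ⟨?_, ?_, fun j => ?_, ?_⟩ <;> rw [entails_iff] <;> intro M _ _ _ v hv
    · rw [← Sum.elim_comp_inl_inr v] at hv
      rw [realize_app0]
      exact ((h M).1 _ _ hv).1
    · rw [← Sum.elim_comp_inl_inr v] at hv
      rw [realize_app0]
      exact ((h M).1 _ _ hv).2
    · rw [Formula.realize_inf, realize_app0, realize_app0] at hv
      refine congrFun ((h M).2.1 (fun i => v (.inl (.inl i))) (fun j => v (.inl (.inr j)))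
        (fun j => v (.inr j)) ?_ ?_) j
      · convert hv.1 using 1
        funext a
        rcases a with a | a <;> rfl
      · convert hv.2 using 1
        funext a
        rcases a with a | a <;> rfl
    · rw [realize_exF]
      exact (h M).2.2 v hv

theorem isArrow_idF (A : ZFCat) : IsArrow A A (idF A) := by
  rw [isArrow_iff]
  intro M _ _ _
  simp only [realize_idF, Sum.elim_inl, Sum.elim_inr]
  refine ⟨fun x y h => ?_, fun x y y' h h' => ?_, fun x hx => ⟨x, hx, fun _ => rfl⟩⟩
  · obtain rfl := funext h.2
    exact ⟨h.1, h.1⟩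
  · rw [← funext h.2, ← funext h'.2]

theorem isArrow_compF {A B C : ZFCat} {F : Fml (Fin A.arity ⊕ Fin B.arity)}
    {G : Fml (Fin B.arity ⊕ Fin C.arity)} (hF : IsArrow A B F) (hG : IsArrow B C G) :
    IsArrow A C (compF F G) := by
  rw [isArrow_iff] at hF hG ⊢
  intro M _ _ _
  simp only [realize_compF, Sum.elim_inl, Sum.elim_inr]
  obtain ⟨f1, f2, f3⟩ := hF M
  obtain ⟨g1, g2, g3⟩ := hG M
  refine ⟨fun x z h => ?_, fun x z z' h h' => ?_, fun x hx => ?_⟩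
  · obtain ⟨y, h, h'⟩ := h
    exact ⟨(f1 _ _ h).1, (g1 _ _ h').2⟩
  · obtain ⟨y, hy, hz⟩ := h
    obtain ⟨y', hy', hz'⟩ := h'
    obtain rfl := f2 _ _ _ hy hy'
    exact g2 _ _ _ hz hz'
  · obtain ⟨y, hy⟩ := f3 x hx
    obtain ⟨z, hz⟩ := g3 y (f1 _ _ hy).2
    exact ⟨z, y, hy, hz⟩

/-- Composition of arrows. -/
def Arrow.comp {A B C : ZFCat} : Arrow A B → Arrow B C → Arrow A C :=
  Quotient.map₂ (fun F G => ⟨compF F.1 G.1, isArrow_compF F.2 G.2⟩) (by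
    intro F F' h G G' h'
    replace h := provable_iff.1 h
    replace h' := provable_iff.1 h'
    refine provable_iff.2 fun M _ _ _ v => ?_
    simp only [Formula.realize_iff] at h h' ⊢
    simp only [realize_compF, h M, h' M])

theorem Arrow.eq_iff {A B : ZFCat} {F G : Fml (Fin A.arity ⊕ Fin B.arity)}
    {hF : IsArrow A B F} {hG : IsArrow A B G} :
    Arrow.mk F hF = Arrow.mk G hG ↔ ∀ (M : Type) [Nonempty M] [LSet.Structure M] [M ⊨ ZF]
      (x : Fin A.arity → M) (y : Fin B.arity → M),
      Formula.Realize F (Sum.elim x y) ↔ Formula.Realize G (Sum.elim x y) := by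
  refine Quotient.eq.trans (Iff.trans (provable_iff (φ := F.iff G)) ?_)
  simp only [Formula.realize_iff]
  refine ⟨fun h M _ _ _ x y => h M _, fun h M _ _ _ v => ?_⟩
  rw [← Sum.elim_comp_inl_inr v]
  exact h M _ _

/-- The syntactic category of ZF. -/
instance : Category ZFCat where
  Hom := Arrow
  id A := Arrow.mk (idF A) (isArrow_idF A)
  comp := Arrow.comp
  id_comp := by
    rintro A B ⟨F, hF⟩
    refine Arrow.eq_iff.2 fun M _ _ _ x y => ?_
    simp only [realize_compF, realize_idF, Sum.elim_inl, Sum.elim_inr]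
    constructor
    · rintro ⟨x', ⟨_, h⟩, h'⟩
      rwa [show x = x' from funext h]
    · exact fun h => ⟨x, ⟨((isArrow_iff.1 hF M).1 _ _ h).1, fun _ => rfl⟩, h⟩
  comp_id := by
    rintro A B ⟨F, hF⟩
    refine Arrow.eq_iff.2 fun M _ _ _ x y => ?_
    simp only [realize_compF, realize_idF, Sum.elim_inl, Sum.elim_inr]
    constructor
    · rintro ⟨y', h, _, h'⟩
      rwa [show y = y' from (funext h').symm]
    · exact fun h => ⟨y, h, ((isArrow_iff.1 hF M).1 _ _ h).2, fun _ => rfl⟩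
  assoc := by
    rintro A B C D ⟨F, hF⟩ ⟨G, hG⟩ ⟨H, hH⟩
    refine Arrow.eq_iff.2 fun M _ _ _ x y => ?_
    simp only [realize_compF, Sum.elim_inl, Sum.elim_inr]
    constructor
    · rintro ⟨z, ⟨w, h1, h2⟩, h3⟩
      exact ⟨w, h1, z, h2, h3⟩
    · rintro ⟨w, h1, z, h2, h3⟩
      exact ⟨z, ⟨w, h1, h2⟩, h3⟩

/-- The formula `F` represents the arrow `f`, that is, `f = [{x, y | F}]`. -/
def Represents {A B : ZFCat} (f : A ⟶ B) (F : Fml (Fin A.arity ⊕ Fin B.arity)) : Prop :=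
  ∃ h : IsArrow A B F, f = Arrow.mk F h

/-! ### Definable classes and definable sets -/

/-- A definable class `{x | P}`. -/
structure DefClass where
  formula : Fml (Fin 1)

/-- A definable class as an object of the syntactic category. -/
def DefClass.toZFCat (A : DefClass) : ZFCat := ⟨1, A.formula⟩

/-- The category `DCL[ZF]` of definable classes: the full subcategory of the syntactic category on
the formulas in context with one variable. -/
abbrev DCL := InducedCategory ZFCat DefClass.toZFCat

/-- The definable sets: `⊢ ∃ z ∀ x (x ∈ z ↔ P)`. -/
def IsDefSet : ObjectProperty DCL := fun A =>
  Provable (α := Empty) ZF (∃' ∀' ((bv 1 ∈' bv 0) ⇔ app (DefClass.formula A) ![bv 1]))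

/-- The category `DST[ZF]` of definable sets, a full subcategory of `DCL[ZF]`. -/
abbrev DST := IsDefSet.FullSubcategory

namespace DST

/-- The formula `P` of a definable set `{x | P}`. -/
def formula (A : DST) : Fml (Fin 1) := DefClass.formula A.obj

/-- A definable set as an object of the syntactic category. -/
abbrev toZFCat (A : DST) : ZFCat := ⟨1, A.formula⟩

/-- An arrow of definable sets as an arrow of the syntactic category. -/
def arrow {A B : DST} (f : A ⟶ B) : A.toZFCat ⟶ B.toZFCat := f.hom.hom

end DST

/-! ### Internal categories and their global elements -/

/-- An internal category of `C`, with a chosen object `C₂` of composable pairs. Associativity is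
stated for generalized elements, that is, for all composable triples of arrows `X ⟶ C₁`. -/
structure InternalCategory (C : Type*) [Category C] where
  C₀ : C
  C₁ : C
  C₂ : C
  d₀ : C₁ ⟶ C₀
  d₁ : C₁ ⟶ C₀
  ident : C₀ ⟶ C₁
  p₀ : C₂ ⟶ C₁
  p₁ : C₂ ⟶ C₁
  comp : C₂ ⟶ C₁
  isPullback : IsPullback p₀ p₁ d₁ d₀
  ident_d₀ : ident ≫ d₀ = 𝟙 C₀
  ident_d₁ : ident ≫ d₁ = 𝟙 C₀
  comp_d₀ : comp ≫ d₀ = p₀ ≫ d₀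
  comp_d₁ : comp ≫ d₁ = p₁ ≫ d₁
  id_comp : isPullback.lift (d₀ ≫ ident) (𝟙 C₁)
    (by rw [Category.assoc, ident_d₁, Category.comp_id, Category.id_comp]) ≫ comp = 𝟙 C₁
  comp_id : isPullback.lift (𝟙 C₁) (d₁ ≫ ident)
    (by rw [Category.assoc, ident_d₀, Category.comp_id, Category.id_comp]) ≫ comp = 𝟙 C₁
  assoc : ∀ {X : C} (f g h : X ⟶ C₁) (hfg : f ≫ d₁ = g ≫ d₀) (hgh : g ≫ d₁ = h ≫ d₀),
    isPullback.lift (isPullback.lift f g hfg ≫ comp) h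
        (by rw [Category.assoc, comp_d₁, isPullback.lift_snd_assoc, hgh]) ≫ comp =
      isPullback.lift f (isPullback.lift g h hgh ≫ comp)
        (by rw [Category.assoc, comp_d₀, isPullback.lift_fst_assoc, hfg]) ≫ comp

/-- The objects of `Γ(S)`: the global elements of the object of objects. -/
structure Gam {C : Type*} [Category C] (S : InternalCategory C) {T : C}
    (hT : Limits.IsTerminal T) where
  name : T ⟶ S.C₀

namespace Gam

variable {C : Type*} [Category C] {S : InternalCategory C} {T : C} {hT : Limits.IsTerminal T}

/-- The arrows of `Γ(S)` from `X` to `Y`: the global elements of the object of arrows with domain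
`X` and codomain `Y`. -/
@[ext]
structure Hom (X Y : Gam S hT) where
  name : T ⟶ S.C₁
  dom : name ≫ S.d₀ = X.name
  cod : name ≫ S.d₁ = Y.name

/-- The category `Γ(S)` of global elements of an internal category `S`. -/
noncomputable instance : Category (Gam S hT) where
  Hom := Hom
  id X := ⟨X.name ≫ S.ident, by rw [Category.assoc, S.ident_d₀, Category.comp_id],
    by rw [Category.assoc, S.ident_d₁, Category.comp_id]⟩
  comp f g := ⟨S.isPullback.lift f.name g.name (f.cod.trans g.dom.symm) ≫ S.comp,
    by rw [Category.assoc, S.comp_d₀, S.isPullback.lift_fst_assoc, f.dom],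
    by rw [Category.assoc, S.comp_d₁, S.isPullback.lift_snd_assoc, g.cod]⟩
  id_comp f := by
    refine Hom.ext ?_
    have h := congrArg (fun k => f.name ≫ k) S.id_comp
    simp only [Category.comp_id, ← Category.assoc] at h
    refine Eq.trans (congrArg (· ≫ S.comp) (S.isPullback.hom_ext ?_ ?_)) h
    · simp only [Category.assoc, S.isPullback.lift_fst]
      rw [← Category.assoc, f.dom]
    · simp
  comp_id f := by
    refine Hom.ext ?_
    have h := congrArg (fun k => f.name ≫ k) S.comp_id
    simp only [Category.comp_id, ← Category.assoc] at h
    refine Eq.trans (congrArg (· ≫ S.comp) (S.isPullback.hom_ext ?_ ?_)) h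
    · simp
    · simp only [Category.assoc, S.isPullback.lift_snd]
      rw [← Category.assoc, f.cod]
  assoc f g h := Hom.ext (S.assoc f.name g.name h.name _ _)

end Gam

/-! ### The internal category of sets -/

/-- `x₀ = {x₁, x₂}`. -/
def upairF : Fml (Fin 3) := ∀' ((bv 0 ∈' fv 0) ⇔ ((bv 0 ≐ fv 1) ⊔ (bv 0 ≐ fv 2)))

/-- `x₀ = ⟨x₁, x₂⟩ = {{x₁}, {x₁, x₂}}`. -/
def pairF : Fml (Fin 3) :=
  ∀' ((bv 0 ∈' fv 0) ⇔ (app upairF ![bv 0, fv 1, fv 1] ⊔ app upairF ![bv 0, fv 1, fv 2]))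

/-- `⟨x₀, x₁⟩ ∈ x₂`. -/
def pairMemF : Fml (Fin 3) := ∃' (app pairF ![bv 0, fv 0, fv 1] ⊓ (bv 0 ∈' fv 2))

/-- `Fun(x₀)`: a set of ordered pairs that is single-valued. -/
def funF : Fml (Fin 1) :=
  (∀' ((bv 0 ∈' fv 0) ⟹ ∃' ∃' (app pairF ![bv 0, bv 1, bv 2]))) ⊓
    ∀' ∀' ∀' ((app pairMemF ![bv 0, bv 1, fv 0] ⊓ app pairMemF ![bv 0, bv 2, fv 0]) ⟹
      (bv 1 ≐ bv 2))

/-- `ran(x₀) ⊆ x₁`. -/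
def ranSubF : Fml (Fin 2) := ∀' ∀' (app pairMemF ![bv 0, bv 1, fv 0] ⟹ (bv 1 ∈' fv 1))

/-- `dom(x₀) = x₁`. -/
def domF : Fml (Fin 2) := ∀' ((bv 0 ∈' fv 1) ⇔ ∃' (app pairMemF ![bv 0, bv 1, fv 0]))

/-- `ran(x₀) ⊆ dom(x₁)`. -/
def ranSubDomF : Fml (Fin 2) :=
  ∀' ∀' (app pairMemF ![bv 0, bv 1, fv 0] ⟹ ∃' (app pairMemF ![bv 1, bv 2, fv 1]))

/-- `x₀ = ⟨x₁, x₂⟩ ∧ Fun(x₁) ∧ ran(x₁) ⊆ x₂`: a function together with a codomain. -/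
def setFunF : Fml (Fin 3) :=
  app pairF ![fv 0, fv 1, fv 2] ⊓ (app funF ![fv 1] ⊓ app ranSubF ![fv 1, fv 2])

/-- `x₀ = ⟨x₁, ⟨x₂, x₃⟩⟩ ∧ Fun(x₁) ∧ Fun(x₂) ∧ ran(x₁) ⊆ dom(x₂) ∧ ran(x₂) ⊆ x₃`. -/
def composableF : Fml (Fin 4) :=
  (∃' (app pairF ![bv 0, fv 2, fv 3] ⊓ app pairF ![fv 0, fv 1, bv 0])) ⊓
    (app funF ![fv 1] ⊓ (app funF ![fv 2] ⊓
      (app ranSubDomF ![fv 1, fv 2] ⊓ app ranSubF ![fv 2, fv 3])))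

/-- `∀ t (t ∈ x₂ ↔ ∃ s ∃ s' ∃ s'' (⟨s, s'⟩ ∈ x₀ ∧ ⟨s', s''⟩ ∈ x₁ ∧ t = ⟨s, s''⟩))`. -/
def graphCompF : Fml (Fin 3) :=
  ∀' ((bv 0 ∈' fv 2) ⇔ ∃' ∃' ∃' (app pairMemF ![bv 1, bv 2, fv 0] ⊓
    (app pairMemF ![bv 2, bv 3, fv 1] ⊓ app pairF ![bv 0, bv 1, bv 3])))

/-- `∀ t (t ∈ x₁ ↔ ∃ s (s ∈ x₀ ∧ t = ⟨s, s⟩))`. -/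
def graphIdF : Fml (Fin 2) :=
  ∀' ((bv 0 ∈' fv 1) ⇔ ∃' ((bv 1 ∈' fv 0) ⊓ app pairF ![bv 0, bv 1, bv 1]))

/-- The source variable of a formula `{x, y | F}`. -/
abbrev src {n : ℕ} : (Fin 1 ⊕ Fin 1) ⊕ Fin n := fv (.inl 0)

/-- The target variable of a formula `{x, y | F}`. -/
abbrev tgt {n : ℕ} : (Fin 1 ⊕ Fin 1) ⊕ Fin n := fv (.inr 0)

/-- The class of all sets. -/
def set₀ : ZFCat := ⟨1, fv 0 ≐ fv 0⟩

/-- The class of all functions with a codomain. -/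
def set₁ : ZFCat := ⟨1, ∃' ∃' (app setFunF ![fv 0, bv 0, bv 1])⟩

/-- The class of all composable pairs. -/
def set₂ : ZFCat := ⟨1, ∃' ∃' ∃' (app composableF ![fv 0, bv 0, bv 1, bv 2])⟩

/-- The formula for the domain. -/
def d₀F : Fml (Fin 1 ⊕ Fin 1) :=
  ∃' ∃' (app setFunF ![src, bv 0, bv 1] ⊓ app domF ![bv 0, tgt])

/-- The formula for the codomain. -/
def d₁F : Fml (Fin 1 ⊕ Fin 1) := ∃' (app setFunF ![src, bv 0, tgt])

/-- The formula for the identity. -/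
def identF : Fml (Fin 1 ⊕ Fin 1) :=
  ∃' (app pairF ![tgt, bv 0, src] ⊓ app graphIdF ![src, bv 0])

/-- The formula for the first projection: `⟨f, ⟨f', z⟩⟩ ↦ ⟨f, dom(f')⟩`. -/
def p₀F : Fml (Fin 1 ⊕ Fin 1) :=
  ∃' ∃' ∃' (app composableF ![src, bv 0, bv 1, bv 2] ⊓
    ∃' (app domF ![bv 1, bv 3] ⊓ app pairF ![tgt, bv 0, bv 3]))

/-- The formula for the second projection: `⟨f, ⟨f', z⟩⟩ ↦ ⟨f', z⟩`. -/
def p₁F : Fml (Fin 1 ⊕ Fin 1) :=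
  ∃' ∃' ∃' (app composableF ![src, bv 0, bv 1, bv 2] ⊓ app pairF ![tgt, bv 1, bv 2])

/-- The formula for the composition. -/
def boxF : Fml (Fin 1 ⊕ Fin 1) :=
  ∃' ∃' ∃' ∃' (app composableF ![src, bv 0, bv 1, bv 2] ⊓
    (app pairF ![tgt, bv 3, bv 2] ⊓ app graphCompF ![bv 0, bv 1, bv 3]))

section Realize

variable {M : Type} [LSet.Structure M]

/-! The relations expressed by the formulas above. -/

def IsUPair (w a b : M) : Prop := ∀ u, E u w ↔ u = a ∨ u = b
def IsPair (p a b : M) : Prop := ∀ w, E w p ↔ IsUPair w a a ∨ IsUPair w a b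
def PairMem (a b f : M) : Prop := ∃ p, IsPair p a b ∧ E p f
def IsFun (f : M) : Prop := (∀ t, E t f → ∃ a b, IsPair t a b) ∧
  ∀ a b b', PairMem a b f ∧ PairMem a b' f → b = b'
def RanSub (f z : M) : Prop := ∀ a b, PairMem a b f → E b z
def IsDom (f x : M) : Prop := ∀ s, E s x ↔ ∃ b, PairMem s b f
def RanSubDom (f g : M) : Prop := ∀ a b, PairMem a b f → ∃ c, PairMem b c g
def SetFun (F f z : M) : Prop := IsPair F f z ∧ IsFun f ∧ RanSub f z
def Composable (J f g z : M) : Prop := (∃ q, IsPair q g z ∧ IsPair J f q) ∧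
  IsFun f ∧ IsFun g ∧ RanSubDom f g ∧ RanSub g z
def GraphComp (f g h : M) : Prop := ∀ t, E t h ↔
  ∃ a b c, PairMem a b f ∧ PairMem b c g ∧ IsPair t a c
def GraphId (x f : M) : Prop := ∀ t, E t f ↔ ∃ s, E s x ∧ IsPair t s s

variable {α : Type} {n : ℕ} (v : α → M) (xs : Fin n → M)

theorem realize_upairF (u : Fin 3 → α ⊕ Fin n) :
    (app upairF u).Realize v xs ↔ IsUPair (Sum.elim v xs (u 0)) (Sum.elim v xs (u 1)) (Sum.elim v xs (u 2)) := by
  rw [realize_app, Formula.Realize, upairF]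
  simp [IsUPair, realize_memF, realize_eqF, Fin.snoc]

theorem realize_pairF (u : Fin 3 → α ⊕ Fin n) :
    (app pairF u).Realize v xs ↔ IsPair (Sum.elim v xs (u 0)) (Sum.elim v xs (u 1)) (Sum.elim v xs (u 2)) := by
  rw [realize_app, Formula.Realize, pairF]
  simp [IsPair, realize_memF, realize_upairF, Fin.snoc]

theorem realize_pairMemF (u : Fin 3 → α ⊕ Fin n) :
    (app pairMemF u).Realize v xs ↔ PairMem (Sum.elim v xs (u 0)) (Sum.elim v xs (u 1)) (Sum.elim v xs (u 2)) := by
  rw [realize_app, Formula.Realize, pairMemF]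
  simp [PairMem, realize_memF, realize_pairF, Fin.snoc]

theorem realize_funF (u : Fin 1 → α ⊕ Fin n) :
    (app funF u).Realize v xs ↔ IsFun (Sum.elim v xs (u 0)) := by
  rw [realize_app, Formula.Realize, funF]
  simp [IsFun, realize_memF, realize_eqF, realize_pairF, realize_pairMemF, Fin.snoc]

theorem realize_ranSubF (u : Fin 2 → α ⊕ Fin n) :
    (app ranSubF u).Realize v xs ↔ RanSub (Sum.elim v xs (u 0)) (Sum.elim v xs (u 1)) := by
  rw [realize_app, Formula.Realize, ranSubF]
  simp [RanSub, realize_memF, realize_pairMemF, Fin.snoc]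

theorem realize_domF (u : Fin 2 → α ⊕ Fin n) :
    (app domF u).Realize v xs ↔ IsDom (Sum.elim v xs (u 0)) (Sum.elim v xs (u 1)) := by
  rw [realize_app, Formula.Realize, domF]
  simp [IsDom, realize_memF, realize_pairMemF, Fin.snoc]

theorem realize_ranSubDomF (u : Fin 2 → α ⊕ Fin n) :
    (app ranSubDomF u).Realize v xs ↔ RanSubDom (Sum.elim v xs (u 0)) (Sum.elim v xs (u 1)) := by
  rw [realize_app, Formula.Realize, ranSubDomF]
  simp [RanSubDom, realize_pairMemF, Fin.snoc]

theorem realize_setFunF (u : Fin 3 → α ⊕ Fin n) :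
    (app setFunF u).Realize v xs ↔ SetFun (Sum.elim v xs (u 0)) (Sum.elim v xs (u 1)) (Sum.elim v xs (u 2)) := by
  rw [realize_app, Formula.Realize, setFunF]
  simp [SetFun, realize_pairF, realize_funF, realize_ranSubF]

theorem realize_composableF (u : Fin 4 → α ⊕ Fin n) :
    (app composableF u).Realize v xs ↔ Composable (Sum.elim v xs (u 0)) (Sum.elim v xs (u 1)) (Sum.elim v xs (u 2)) (Sum.elim v xs (u 3)) := by
  rw [realize_app, Formula.Realize, composableF]
  simp [Composable, realize_pairF, realize_funF, realize_ranSubF, realize_ranSubDomF, Fin.snoc]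

theorem realize_graphCompF (u : Fin 3 → α ⊕ Fin n) :
    (app graphCompF u).Realize v xs ↔ GraphComp (Sum.elim v xs (u 0)) (Sum.elim v xs (u 1)) (Sum.elim v xs (u 2)) := by
  rw [realize_app, Formula.Realize, graphCompF]
  simp [GraphComp, realize_memF, realize_pairF, realize_pairMemF, Fin.snoc]

theorem realize_graphIdF (u : Fin 2 → α ⊕ Fin n) :
    (app graphIdF u).Realize v xs ↔ GraphId (Sum.elim v xs (u 0)) (Sum.elim v xs (u 1)) := by
  rw [realize_app, Formula.Realize, graphIdF]
  simp [GraphId, realize_memF, realize_pairF, Fin.snoc]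

end Realize

/-! ### Arrows as definable relations -/

/-- The interpretation of an object in a model. -/
def Holds (A : ZFCat) {M : Type} [LSet.Structure M] (x : Fin A.arity → M) : Prop :=
  Formula.Realize A.formula x

/-- The interpretation of an arrow in a model. -/
def Rel {A B : ZFCat} (f : A ⟶ B) {M : Type} [Nonempty M] [LSet.Structure M] [M ⊨ ZF]
    (x : Fin A.arity → M) (y : Fin B.arity → M) : Prop :=
  Quotient.lift (s := arrowSetoid A B) (fun F => Formula.Realize F.1 (Sum.elim x y))
    (fun _ _ h => propext (Arrow.eq_iff.1 (Quotient.sound h) M x y)) f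

section Rel

variable {A B C D : ZFCat} {M : Type} [Nonempty M] [LSet.Structure M] [M ⊨ ZF]

theorem Rel.holds {f : A ⟶ B} {x : Fin A.arity → M} {y : Fin B.arity → M} (h : Rel f x y) :
    Holds A x ∧ Holds B y := by
  obtain ⟨F, hF⟩ := f
  exact (isArrow_iff.1 hF M).1 x y h

theorem Rel.unique {f : A ⟶ B} {x : Fin A.arity → M} {y y' : Fin B.arity → M} (h : Rel f x y)
    (h' : Rel f x y') : y = y' := by
  obtain ⟨F, hF⟩ := f
  exact (isArrow_iff.1 hF M).2.1 x y y' h h'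

theorem Rel.total (f : A ⟶ B) {x : Fin A.arity → M} (h : Holds A x) : ∃ y, Rel f x y := by
  obtain ⟨F, hF⟩ := f
  exact (isArrow_iff.1 hF M).2.2 x h

theorem rel_comp {f : A ⟶ B} {g : B ⟶ C} {x : Fin A.arity → M} {z : Fin C.arity → M} :
    Rel (f ≫ g) x z ↔ ∃ y, Rel f x y ∧ Rel g y z := by
  obtain ⟨F, hF⟩ := f
  obtain ⟨G, hG⟩ := g
  exact realize_compF F G _

theorem rel_id {x y : Fin A.arity → M} : Rel (𝟙 A) x y ↔ Holds A x ∧ x = y := by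
  refine (realize_idF A (Sum.elim x y)).trans (and_congr Iff.rfl ?_)
  exact funext_iff.symm

end Rel

theorem hom_ext {A B : ZFCat} {f g : A ⟶ B} (h : ∀ (M : Type) [Nonempty M] [LSet.Structure M]
    [M ⊨ ZF] (x : Fin A.arity → M) (y : Fin B.arity → M), Rel f x y → Rel g x y) : f = g := by
  obtain ⟨F, hF⟩ := f
  obtain ⟨G, hG⟩ := g
  refine Arrow.eq_iff.2 fun M _ _ _ x y => ⟨h M x y, fun hg => ?_⟩
  obtain ⟨y', hy⟩ := (isArrow_iff.1 hF M).2.2 x ((isArrow_iff.1 hG M).1 x y hg).1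
  obtain rfl := (isArrow_iff.1 hG M).2.1 x y y' hg (h M x y' hy)
  exact hy

theorem isPullback_of_rel {P A B C : ZFCat} {p : P ⟶ A} {q : P ⟶ B} {f : A ⟶ C} {g : B ⟶ C}
    (w : p ≫ f = q ≫ g)
    (hex : ∀ (M : Type) [Nonempty M] [LSet.Structure M] [M ⊨ ZF] (a : Fin A.arity → M)
      (b : Fin B.arity → M) (c : Fin C.arity → M), Rel f a c → Rel g b c →
        ∃ x, Rel p x a ∧ Rel q x b)
    (hun : ∀ (M : Type) [Nonempty M] [LSet.Structure M] [M ⊨ ZF] (a : Fin A.arity → M)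
      (b : Fin B.arity → M) (x x' : Fin P.arity → M), Rel p x a → Rel q x b → Rel p x' a →
        Rel q x' b → x = x') : IsPullback p q f g := by
  have lift : ∀ (s : Limits.PullbackCone f g), ∃ l : s.pt ⟶ P, l ≫ p = s.fst ∧ l ≫ q = s.snd := by
    intro s
    obtain ⟨K, hK⟩ : ∃ K : Fml (Fin s.pt.arity ⊕ Fin P.arity), ∀ (M : Type) [Nonempty M]
        [LSet.Structure M] [M ⊨ ZF] (z : Fin s.pt.arity → M) (x : Fin P.arity → M),
        Formula.Realize K (Sum.elim z x) ↔
          (∃ a, Rel s.fst z a ∧ Rel p x a) ∧ ∃ b, Rel s.snd z b ∧ Rel q x b := by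
      have aux : ∀ {Z A : ZFCat} (u : Z ⟶ A) (p : P ⟶ A), ∃ K : Fml (Fin Z.arity ⊕ Fin P.arity),
          ∀ (M : Type) [Nonempty M] [LSet.Structure M] [M ⊨ ZF] (z : Fin Z.arity → M)
            (x : Fin P.arity → M), Formula.Realize K (Sum.elim z x) ↔
              ∃ a, Rel u z a ∧ Rel p x a := by
        intro Z A u p
        obtain ⟨F, hF⟩ := u
        obtain ⟨G, hG⟩ := p
        refine ⟨exF (m := A.arity) (app F (Sum.elim (fun i => fv (.inl (.inl i))) fun j =>
          fv (.inr j)) ⊓ app G (Sum.elim (fun j => fv (.inl (.inr j))) fun k => fv (.inr k))),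
          fun M _ _ _ z x => ?_⟩
        rw [realize_exF]
        refine exists_congr fun y => ?_
        rw [Formula.realize_inf, realize_app0, realize_app0]
        refine iff_of_eq (congrArg₂ And (congrArg _ ?_) (congrArg _ ?_)) <;>
        · funext a
          rcases a with a | a <;> rfl
      obtain ⟨K, hK⟩ := aux s.fst p
      obtain ⟨K', hK'⟩ := aux s.snd q
      exact ⟨K ⊓ K', fun M _ _ _ z x => by rw [Formula.realize_inf, hK, hK']⟩
    have harr : IsArrow s.pt P K := by
      rw [isArrow_iff]
      intro M _ _ _
      simp only [hK]
      refine ⟨?_, ?_, ?_⟩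
      · rintro z x ⟨⟨a, ha, hp⟩, -⟩
        exact ⟨ha.holds.1, hp.holds.1⟩
      · rintro z x x' ⟨⟨a, ha, hp⟩, b, hb, hq⟩ ⟨⟨a', ha', hp'⟩, b', hb', hq'⟩
        obtain rfl := ha.unique ha'
        obtain rfl := hb.unique hb'
        exact hun M a b x x' hp hq hp' hq'
      · intro z hz
        obtain ⟨a, ha⟩ := Rel.total s.fst hz
        obtain ⟨b, hb⟩ := Rel.total s.snd hz
        obtain ⟨c, hc⟩ := Rel.total f ha.holds.2
        have hc' : Rel (s.snd ≫ g) z c := by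
          rw [← s.condition, rel_comp]
          exact ⟨a, ha, hc⟩
        obtain ⟨b', hb', hg⟩ := rel_comp.1 hc'
        obtain rfl := hb.unique hb'
        obtain ⟨x, hp, hq⟩ := hex M a b c hc hg
        exact ⟨x, ⟨a, ha, hp⟩, b, hb, hq⟩
    refine ⟨Arrow.mk K harr, hom_ext fun M _ _ _ z a h => ?_, hom_ext fun M _ _ _ z b h => ?_⟩
    · obtain ⟨x, hx, hp⟩ := rel_comp.1 h
      obtain ⟨⟨a', ha', hp'⟩, -⟩ := (hK M z x).1 hx
      rwa [hp.unique hp']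
    · obtain ⟨x, hx, hp⟩ := rel_comp.1 h
      obtain ⟨-, a', ha', hp'⟩ := (hK M z x).1 hx
      rwa [hp.unique hp']
  choose l hl using lift
  refine ⟨⟨w⟩, ⟨Limits.PullbackCone.IsLimit.mk w l (fun s => (hl s).1) (fun s => (hl s).2) ?_⟩⟩
  intro s m h1 h2
  refine hom_ext fun M _ _ _ z x h => ?_
  obtain ⟨x', hx'⟩ := Rel.total (l s) h.holds.1
  have key : ∀ {D : ZFCat} (p : P ⟶ D) (u : s.pt ⟶ D), m ≫ p = u → l s ≫ p = u →
      ∃ d, Rel p x d ∧ Rel p x' d := by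
    intro D p u hm hl
    obtain ⟨d, hd⟩ := Rel.total p h.holds.2
    have hd' : Rel (l s ≫ p) z d := by
      rw [hl, ← hm, rel_comp]
      exact ⟨x, h, hd⟩
    obtain ⟨x'', hx'', hd'⟩ := rel_comp.1 hd'
    obtain rfl := hx'.unique hx''
    exact ⟨d, hd, hd'⟩
  obtain ⟨a, ha, ha'⟩ := key p _ h1 (hl s).1
  obtain ⟨b, hb, hb'⟩ := key q _ h2 (hl s).2
  rwa [hun M a b x x' ha hb ha' hb']

/-! ### Elementary set theory in a model of ZF -/

section Model

variable {M : Type} [LSet.Structure M] [hM : M ⊨ ZF]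

theorem zf_ext {x y : M} (h : ∀ t, E t x ↔ E t y) : x = y := by
  have := hM.realize_of_mem _ IsZFAxiom.extensionality
  simp [extAx, Sentence.Realize, Formula.Realize, realize_memF, realize_eqF, Fin.snoc] at this
  exact this x y h

theorem zf_sep {k : ℕ} (P : Fml (Fin k ⊕ Fin 1)) (v : Fin k → M) (x : M) :
    ∃ y, ∀ t, E t y ↔ E t x ∧ Formula.Realize P (Sum.elim v fun _ => t) := by
  have := (realize_close _).1 (hM.realize_of_mem _ (IsZFAxiom.separation k P)) v
  simp [Formula.Realize, realize_memF, realize_app, Fin.snoc] at this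
  obtain ⟨y, hy⟩ := this x
  refine ⟨y, fun t => (hy t).trans (and_congr Iff.rfl (iff_of_eq ?_))⟩
  rw [Formula.Realize]
  congr 1
  funext a
  rcases a with a | a
  · rfl
  · obtain rfl : a = 0 := Subsingleton.elim _ _
    rfl

theorem zf_pair (a b : M) : ∃ w, IsUPair w a b := by
  have := hM.realize_of_mem _ IsZFAxiom.pairing
  simp [pairAx, Sentence.Realize, Formula.Realize, realize_memF, realize_eqF, Fin.snoc] at this
  exact this a b

theorem zf_union (x : M) : ∃ y, ∀ t, E t y ↔ ∃ s, E t s ∧ E s x := by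
  have := hM.realize_of_mem _ IsZFAxiom.union
  simp [unionAx, Sentence.Realize, Formula.Realize, realize_memF, Fin.snoc] at this
  exact this x

theorem zf_power (x : M) : ∃ y, ∀ t, E t y ↔ ∀ s, E s t → E s x := by
  have := hM.realize_of_mem _ IsZFAxiom.power
  simp [powerAx, Sentence.Realize, Formula.Realize, realize_memF, realize_app, Fin.snoc] at this
  obtain ⟨y, hy⟩ := this x
  refine ⟨y, fun t => (hy t).trans ?_⟩
  simp [subsetF, realize_memF, Fin.snoc]

end Model

section Model

variable {M : Type} [LSet.Structure M]

theorem SetFun.mk_pair {F f z : M} (h : SetFun F f z) : IsPair F f z := h.1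

variable [hM : M ⊨ ZF]

theorem upair_unique {w w' a b : M} (h : IsUPair w a b) (h' : IsUPair w' a b) : w = w' :=
  zf_ext fun t => (h t).trans (h' t).symm

theorem exists_pair (a b : M) : ∃ p, IsPair p a b := by
  obtain ⟨s, hs⟩ := zf_pair a a
  obtain ⟨d, hd⟩ := zf_pair a b
  obtain ⟨p, hp⟩ := zf_pair s d
  refine ⟨p, fun w => (hp w).trans (or_congr ⟨?_, ?_⟩ ⟨?_, ?_⟩)⟩
  · rintro rfl
    exact hs
  · exact fun h => upair_unique h hs
  · rintro rfl
    exact hd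
  · exact fun h => upair_unique h hd

theorem pair_unique {p p' a b : M} (h : IsPair p a b) (h' : IsPair p' a b) : p = p' :=
  zf_ext fun t => (h t).trans (h' t).symm

theorem pair_inj {p a b c d : M} (h : IsPair p a b) (h' : IsPair p c d) : a = c ∧ b = d := by
  have hw : ∀ w, (IsUPair w a a ∨ IsUPair w a b) ↔ (IsUPair w c c ∨ IsUPair w c d) :=
    fun w => (h w).symm.trans (h' w)
  obtain ⟨sa, hsa⟩ := zf_pair a a
  obtain ⟨sc, hsc⟩ := zf_pair c c
  obtain ⟨ab, hab⟩ := zf_pair a b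
  obtain ⟨cd, hcd⟩ := zf_pair c d
  have hac : a = c := by
    rcases (hw sa).1 (Or.inl hsa) with k | k
    · have := (k c).2 (Or.inl rfl)
      rcases (hsa c).1 this with e | e <;> exact e.symm
    · have := (k c).2 (Or.inl rfl)
      rcases (hsa c).1 this with e | e <;> exact e.symm
  subst hac
  refine ⟨rfl, ?_⟩
  have h1 : b = a ∨ b = d := by
    rcases (hw ab).1 (Or.inr hab) with k | k
    · exact Or.inl (by rcases (k b).1 ((hab b).2 (Or.inr rfl)) with e | e <;> exact e)
    · exact (k b).1 ((hab b).2 (Or.inr rfl))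
  have h2 : d = a ∨ d = b := by
    rcases (hw cd).2 (Or.inr hcd) with k | k
    · exact Or.inl (by rcases (k d).1 ((hcd d).2 (Or.inr rfl)) with e | e <;> exact e)
    · exact (k d).1 ((hcd d).2 (Or.inr rfl))
  rcases h1 with h1 | h1
  · rcases h2 with h2 | h2
    · rw [h1, h2]
    · exact h2.symm
  · exact h1

theorem exists_field (f : M) : ∃ u, ∀ a b, PairMem a b f → E a u ∧ E b u := by
  obtain ⟨y, hy⟩ := zf_union f
  obtain ⟨u, hu⟩ := zf_union y
  refine ⟨u, fun a b ⟨p, hp, hpf⟩ => ?_⟩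
  obtain ⟨d, hd⟩ := zf_pair a b
  have hdy : E d y := (hy d).2 ⟨p, (hp d).2 (Or.inr hd), hpf⟩
  exact ⟨(hu a).2 ⟨d, (hd a).2 (Or.inl rfl), hdy⟩, (hu b).2 ⟨d, (hd b).2 (Or.inr rfl), hdy⟩⟩

theorem exists_square (u : M) : ∃ w, ∀ a b p, E a u → E b u → IsPair p a b → E p w := by
  obtain ⟨y, hy⟩ := zf_power u
  obtain ⟨w, hw⟩ := zf_power y
  refine ⟨w, fun a b p ha hb hp => (hw p).2 fun s hs => (hy s).2 fun t ht => ?_⟩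
  rcases (hp s).1 hs with h | h
  · rcases (h t).1 ht with rfl | rfl <;> exact ha
  · rcases (h t).1 ht with rfl | rfl
    · exact ha
    · exact hb

theorem exists_dom (f : M) : ∃ x, IsDom f x := by
  obtain ⟨u, hu⟩ := exists_field f
  obtain ⟨x, hx⟩ := zf_sep (k := 1) (∃' (app pairMemF ![fv (.inr 0), bv 0, fv (.inl 0)]))
    (fun _ => f) u
  refine ⟨x, fun s => (hx s).trans ?_⟩
  have : Formula.Realize (∃' (app pairMemF ![fv (.inr 0), bv 0, fv (.inl 0)]) :
      Fml (Fin 1 ⊕ Fin 1)) (Sum.elim (fun _ => f) fun _ => s) ↔ ∃ b, PairMem s b f := by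
    rw [Formula.Realize]
    simp [realize_pairMemF, Fin.snoc]
  rw [this]
  exact ⟨fun h => h.2, fun ⟨b, h⟩ => ⟨(hu s b h).1, b, h⟩⟩

theorem dom_unique {f x x' : M} (h : IsDom f x) (h' : IsDom f x') : x = x' :=
  zf_ext fun t => (h t).trans (h' t).symm

theorem exists_graphId (x : M) : ∃ f, GraphId x f := by
  obtain ⟨w, hw⟩ := exists_square x
  obtain ⟨f, hf⟩ := zf_sep (k := 1)
    (∃' ((bv 0 ∈' fv (.inl 0)) ⊓ app pairF ![fv (.inr 0), bv 0, bv 0])) (fun _ => x) w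
  refine ⟨f, fun t => (hf t).trans ?_⟩
  have : Formula.Realize (∃' ((bv 0 ∈' fv (.inl 0)) ⊓ app pairF ![fv (.inr 0), bv 0, bv 0]) :
      Fml (Fin 1 ⊕ Fin 1)) (Sum.elim (fun _ => x) fun _ => t) ↔ ∃ s, E s x ∧ IsPair t s s := by
    rw [Formula.Realize]
    simp [realize_pairF, realize_memF, Fin.snoc]
  rw [this]
  exact ⟨fun h => h.2, fun ⟨s, h, h'⟩ => ⟨hw s s t h h h', s, h, h'⟩⟩

theorem exists_graphComp (f g : M) : ∃ h, GraphComp f g h := by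
  obtain ⟨u, hu⟩ := exists_field f
  obtain ⟨u', hu'⟩ := exists_field g
  obtain ⟨c, hc⟩ := zf_pair u u'
  obtain ⟨y, hy⟩ := zf_union c
  obtain ⟨w, hw⟩ := exists_square y
  obtain ⟨h, hh⟩ := zf_sep (k := 2)
    (∃' ∃' ∃' (app pairMemF ![bv 0, bv 1, fv (.inl 0)] ⊓
      (app pairMemF ![bv 1, bv 2, fv (.inl 1)] ⊓ app pairF ![fv (.inr 0), bv 0, bv 2])))
    ![f, g] w
  refine ⟨h, fun t => (hh t).trans ?_⟩
  have : Formula.Realize (∃' ∃' ∃' (app pairMemF ![bv 0, bv 1, fv (.inl 0)] ⊓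
      (app pairMemF ![bv 1, bv 2, fv (.inl 1)] ⊓ app pairF ![fv (.inr 0), bv 0, bv 2])) :
      Fml (Fin 2 ⊕ Fin 1)) (Sum.elim ![f, g] fun _ => t) ↔
        ∃ a b c, PairMem a b f ∧ PairMem b c g ∧ IsPair t a c := by
    rw [Formula.Realize]
    simp [realize_pairF, realize_pairMemF, Fin.snoc]
  rw [this]
  refine ⟨fun h => h.2, fun ⟨a, b, d, h, h', h''⟩ => ⟨hw a d t ?_ ?_ h'', a, b, d, h, h', h''⟩⟩
  · exact (hy a).2 ⟨u, (hu a b h).1, (hc u).2 (Or.inl rfl)⟩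
  · exact (hy d).2 ⟨u', (hu' b d h').2, (hc u').2 (Or.inr rfl)⟩

theorem GraphComp.pairMem {f g h : M} (H : GraphComp f g h) (a c : M) :
    PairMem a c h ↔ ∃ b, PairMem a b f ∧ PairMem b c g := by
  constructor
  · rintro ⟨p, hp, hph⟩
    obtain ⟨a', b, c', h1, h2, h3⟩ := (H p).1 hph
    obtain ⟨rfl, rfl⟩ := pair_inj hp h3
    exact ⟨b, h1, h2⟩
  · rintro ⟨b, h1, h2⟩
    obtain ⟨p, hp⟩ := exists_pair a c
    exact ⟨p, hp, (H p).2 ⟨a, b, c, h1, h2, hp⟩⟩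

theorem GraphId.pairMem {x f : M} (H : GraphId x f) (a b : M) :
    PairMem a b f ↔ E a x ∧ a = b := by
  constructor
  · rintro ⟨p, hp, hpf⟩
    obtain ⟨s, hs, hs'⟩ := (H p).1 hpf
    obtain ⟨rfl, rfl⟩ := pair_inj hp hs'
    exact ⟨hs, rfl⟩
  · rintro ⟨h, rfl⟩
    obtain ⟨p, hp⟩ := exists_pair a a
    exact ⟨p, hp, (H p).2 ⟨a, h, hp⟩⟩

theorem GraphComp.isFun {f g h : M} (H : GraphComp f g h) (hf : IsFun f) (hg : IsFun g) :
    IsFun h := by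
  refine ⟨fun t ht => ?_, fun a b b' ⟨h1, h2⟩ => ?_⟩
  · obtain ⟨a, b, c, -, -, h⟩ := (H t).1 ht
    exact ⟨a, c, h⟩
  · obtain ⟨d, h3, h4⟩ := (H.pairMem a b).1 h1
    obtain ⟨d', h5, h6⟩ := (H.pairMem a b').1 h2
    obtain rfl := hf.2 _ _ _ ⟨h3, h5⟩
    exact hg.2 _ _ _ ⟨h4, h6⟩

theorem GraphId.isFun {x f : M} (H : GraphId x f) : IsFun f := by
  refine ⟨fun t ht => ?_, fun a b b' ⟨h1, h2⟩ => ?_⟩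
  · obtain ⟨s, -, h⟩ := (H t).1 ht
    exact ⟨s, s, h⟩
  · rw [← ((H.pairMem _ _).1 h1).2, ← ((H.pairMem _ _).1 h2).2]

/-- Functional extensionality. -/
theorem IsFun.ext {f g : M} (hf : IsFun f) (hg : IsFun g)
    (h : ∀ a b, PairMem a b f ↔ PairMem a b g) : f = g := by
  have aux : ∀ {f g : M}, IsFun f → (∀ a b, PairMem a b f → PairMem a b g) →
      ∀ t, E t f → E t g := by
    intro f g hf h t ht
    obtain ⟨a, b, hp⟩ := hf.1 t ht
    obtain ⟨p, hp', hpg⟩ := h a b ⟨t, hp, ht⟩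
    rwa [pair_unique hp hp']
  exact zf_ext fun t => ⟨aux hf (fun a b => (h a b).1) t, aux hg (fun a b => (h a b).2) t⟩

theorem SetFun.inj {F f f' z z' : M} (h : SetFun F f z) (h' : SetFun F f' z') :
    f = f' ∧ z = z' := pair_inj h.1 h'.1

theorem Composable.inj {J f g z f' g' z' : M} (h : Composable J f g z)
    (h' : Composable J f' g' z') : f = f' ∧ g = g' ∧ z = z' := by
  obtain ⟨⟨q, hq, hJ⟩, -⟩ := h
  obtain ⟨⟨q', hq', hJ'⟩, -⟩ := h'
  obtain ⟨rfl, rfl⟩ := pair_inj hJ hJ'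
  exact ⟨rfl, pair_inj hq hq'⟩

end Model

/-! ### The structure maps of the internal category of sets -/

theorem eq_of_zero {M : Type} {x y : Fin 1 → M} (h : x 0 = y 0) : x = y := by
  funext i
  rw [Subsingleton.elim i 0, h]

section Realize

variable {M : Type} [LSet.Structure M]

theorem holds_set₀ (x : Fin 1 → M) : Holds set₀ x := rfl

theorem holds_set₁ (x : Fin 1 → M) : Holds set₁ x ↔ ∃ f z, SetFun (x 0) f z := by
  simp [Holds, set₁, Formula.Realize, realize_setFunF, Fin.snoc]

theorem holds_set₂ (x : Fin 1 → M) : Holds set₂ x ↔ ∃ f g z, Composable (x 0) f g z := by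
  simp [Holds, set₂, Formula.Realize, realize_composableF, Fin.snoc]

variable (x y : Fin 1 → M)

theorem realize_d₀F : Formula.Realize d₀F (Sum.elim x y) ↔
    ∃ f z, SetFun (x 0) f z ∧ IsDom f (y 0) := by
  simp [d₀F, Formula.Realize, realize_setFunF, realize_domF, Fin.snoc]

theorem realize_d₁F : Formula.Realize d₁F (Sum.elim x y) ↔ ∃ f, SetFun (x 0) f (y 0) := by
  simp [d₁F, Formula.Realize, realize_setFunF, Fin.snoc]

theorem realize_identF : Formula.Realize identF (Sum.elim x y) ↔
    ∃ f, IsPair (y 0) f (x 0) ∧ GraphId (x 0) f := by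
  simp [identF, Formula.Realize, realize_pairF, realize_graphIdF, Fin.snoc]

theorem realize_p₀F : Formula.Realize p₀F (Sum.elim x y) ↔
    ∃ f g z, Composable (x 0) f g z ∧ ∃ w, IsDom g w ∧ IsPair (y 0) f w := by
  simp [p₀F, Formula.Realize, realize_composableF, realize_domF, realize_pairF, Fin.snoc]

theorem realize_p₁F : Formula.Realize p₁F (Sum.elim x y) ↔
    ∃ f g z, Composable (x 0) f g z ∧ IsPair (y 0) g z := by
  simp [p₁F, Formula.Realize, realize_composableF, realize_pairF, Fin.snoc]

theorem realize_boxF : Formula.Realize boxF (Sum.elim x y) ↔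
    ∃ f g z h, Composable (x 0) f g z ∧ IsPair (y 0) h z ∧ GraphComp f g h := by
  simp [boxF, Formula.Realize, realize_composableF, realize_pairF, realize_graphCompF, Fin.snoc]

end Realize

theorem isArrow_one {P Q : Fml (Fin 1)} {F : Fml (Fin 1 ⊕ Fin 1)}
    (h : ∀ (M : Type) [Nonempty M] [LSet.Structure M] [M ⊨ ZF],
      (∀ x y : Fin 1 → M, Formula.Realize F (Sum.elim x y) →
        Formula.Realize P x ∧ Formula.Realize Q y) ∧
      (∀ x y y' : Fin 1 → M, Formula.Realize F (Sum.elim x y) →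
        Formula.Realize F (Sum.elim x y') → y 0 = y' 0) ∧
      ∀ x : Fin 1 → M, Formula.Realize P x → ∃ y : M, Formula.Realize F (Sum.elim x fun _ => y)) :
    IsArrow ⟨1, P⟩ ⟨1, Q⟩ F := by
  rw [isArrow_iff]
  intro M _ _ _
  refine ⟨(h M).1, fun x y y' hy hy' => eq_of_zero ((h M).2.1 x y y' hy hy'), fun x hx => ?_⟩
  obtain ⟨y, hy⟩ := (h M).2.2 x hx
  exact ⟨_, hy⟩

theorem isArrow_d₀F : IsArrow set₁ set₀ d₀F := by
  refine isArrow_one fun M _ _ _ => ?_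
  simp only [realize_d₀F]
  refine ⟨?_, ?_, fun x hx => ?_⟩
  · rintro x y ⟨f, z, h, -⟩
    exact ⟨(holds_set₁ x).2 ⟨f, z, h⟩, holds_set₀ y⟩
  · rintro x y y' ⟨f, z, h, hd⟩ ⟨f', z', h', hd'⟩
    obtain ⟨rfl, rfl⟩ := h.inj h'
    exact dom_unique hd hd'
  · obtain ⟨f, z, h⟩ := (holds_set₁ x).1 hx
    obtain ⟨y, hy⟩ := exists_dom f
    exact ⟨y, f, z, h, hy⟩

theorem isArrow_d₁F : IsArrow set₁ set₀ d₁F := by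
  refine isArrow_one fun M _ _ _ => ?_
  simp only [realize_d₁F]
  refine ⟨?_, ?_, fun x hx => ?_⟩
  · rintro x y ⟨f, h⟩
    exact ⟨(holds_set₁ x).2 ⟨f, _, h⟩, holds_set₀ y⟩
  · rintro x y y' ⟨f, h⟩ ⟨f', h'⟩
    exact (h.inj h').2
  · obtain ⟨f, z, h⟩ := (holds_set₁ x).1 hx
    exact ⟨z, f, h⟩

theorem GraphId.setFun {M : Type} [LSet.Structure M] [M ⊨ ZF] {x f F : M} (h : GraphId x f)
    (hF : IsPair F f x) : SetFun F f x := by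
  refine ⟨hF, h.isFun, fun a b hab => ?_⟩
  obtain ⟨ha, rfl⟩ := (h.pairMem a b).1 hab
  exact ha

theorem isArrow_identF : IsArrow set₀ set₁ identF := by
  refine isArrow_one fun M _ _ _ => ?_
  simp only [realize_identF]
  refine ⟨?_, ?_, fun x _ => ?_⟩
  · rintro x y ⟨f, h, hf⟩
    exact ⟨holds_set₀ x, (holds_set₁ y).2 ⟨f, _, hf.setFun h⟩⟩
  · rintro x y y' ⟨f, h, hf⟩ ⟨f', h', hf'⟩
    obtain rfl : f = f' := zf_ext fun t => (hf t).trans (hf' t).symm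
    exact pair_unique h h'
  · obtain ⟨f, hf⟩ := exists_graphId (x 0)
    obtain ⟨y, hy⟩ := exists_pair f (x 0)
    exact ⟨y, f, hy, hf⟩

theorem Composable.setFun₀ {M : Type} [LSet.Structure M] [M ⊨ ZF] {J f g z w F : M}
    (h : Composable J f g z) (hw : IsDom g w) (hF : IsPair F f w) : SetFun F f w :=
  ⟨hF, h.2.1, fun a b hab => (hw b).2 (h.2.2.2.1 a b hab)⟩

theorem Composable.setFun₁ {M : Type} [LSet.Structure M] {J f g z F : M}
    (h : Composable J f g z) (hF : IsPair F g z) : SetFun F g z := ⟨hF, h.2.2.1, h.2.2.2.2⟩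

theorem Composable.setFun {M : Type} [LSet.Structure M] [M ⊨ ZF] {J f g z k F : M}
    (h : Composable J f g z) (hF : IsPair F k z) (hk : GraphComp f g k) : SetFun F k z := by
  refine ⟨hF, hk.isFun h.2.1 h.2.2.1, fun a b hab => ?_⟩
  obtain ⟨c, -, hc⟩ := (hk.pairMem a b).1 hab
  exact h.2.2.2.2 _ _ hc

theorem isArrow_p₀F : IsArrow set₂ set₁ p₀F := by
  refine isArrow_one fun M _ _ _ => ?_
  simp only [realize_p₀F]
  refine ⟨?_, ?_, fun x hx => ?_⟩
  · rintro x y ⟨f, g, z, h, w, hw, hy⟩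
    exact ⟨(holds_set₂ x).2 ⟨f, g, z, h⟩, (holds_set₁ y).2 ⟨f, w, h.setFun₀ hw hy⟩⟩
  · rintro x y y' ⟨f, g, z, h, w, hw, hy⟩ ⟨f', g', z', h', w', hw', hy'⟩
    obtain ⟨rfl, rfl, rfl⟩ := h.inj h'
    obtain rfl := dom_unique hw hw'
    exact pair_unique hy hy'
  · obtain ⟨f, g, z, h⟩ := (holds_set₂ x).1 hx
    obtain ⟨w, hw⟩ := exists_dom g
    obtain ⟨y, hy⟩ := exists_pair f w
    exact ⟨y, f, g, z, h, w, hw, hy⟩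

theorem isArrow_p₁F : IsArrow set₂ set₁ p₁F := by
  refine isArrow_one fun M _ _ _ => ?_
  simp only [realize_p₁F]
  refine ⟨?_, ?_, fun x hx => ?_⟩
  · rintro x y ⟨f, g, z, h, hy⟩
    exact ⟨(holds_set₂ x).2 ⟨f, g, z, h⟩, (holds_set₁ y).2 ⟨g, z, h.setFun₁ hy⟩⟩
  · rintro x y y' ⟨f, g, z, h, hy⟩ ⟨f', g', z', h', hy'⟩
    obtain ⟨rfl, rfl, rfl⟩ := h.inj h'
    exact pair_unique hy hy'
  · obtain ⟨f, g, z, h⟩ := (holds_set₂ x).1 hx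
    obtain ⟨y, hy⟩ := exists_pair g z
    exact ⟨y, f, g, z, h, hy⟩

theorem isArrow_boxF : IsArrow set₂ set₁ boxF := by
  refine isArrow_one fun M _ _ _ => ?_
  simp only [realize_boxF]
  refine ⟨?_, ?_, fun x hx => ?_⟩
  · rintro x y ⟨f, g, z, k, h, hy, hk⟩
    exact ⟨(holds_set₂ x).2 ⟨f, g, z, h⟩, (holds_set₁ y).2 ⟨k, z, h.setFun hy hk⟩⟩
  · rintro x y y' ⟨f, g, z, k, h, hy, hk⟩ ⟨f', g', z', k', h', hy', hk'⟩
    obtain ⟨rfl, rfl, rfl⟩ := h.inj h'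
    obtain rfl : k = k' := zf_ext fun t => (hk t).trans (hk' t).symm
    exact pair_unique hy hy'
  · obtain ⟨f, g, z, h⟩ := (holds_set₂ x).1 hx
    obtain ⟨k, hk⟩ := exists_graphComp f g
    obtain ⟨y, hy⟩ := exists_pair k z
    exact ⟨y, f, g, z, k, h, hy, hk⟩

/-! ### The internal category of sets and its global elements -/

namespace SetCat

def d₀ : set₁ ⟶ set₀ := Arrow.mk d₀F isArrow_d₀F
def d₁ : set₁ ⟶ set₀ := Arrow.mk d₁F isArrow_d₁F
def ident : set₀ ⟶ set₁ := Arrow.mk identF isArrow_identF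
def p₀ : set₂ ⟶ set₁ := Arrow.mk p₀F isArrow_p₀F
def p₁ : set₂ ⟶ set₁ := Arrow.mk p₁F isArrow_p₁F
def box : set₂ ⟶ set₁ := Arrow.mk boxF isArrow_boxF

section

variable {M : Type} [Nonempty M] [LSet.Structure M] [M ⊨ ZF] {x y : Fin 1 → M}

theorem rel_d₀ : Rel d₀ x y ↔ ∃ f z, SetFun (x 0) f z ∧ IsDom f (y 0) := realize_d₀F x y
theorem rel_d₁ : Rel d₁ x y ↔ ∃ f, SetFun (x 0) f (y 0) := realize_d₁F x y
theorem rel_ident : Rel ident x y ↔ ∃ f, IsPair (y 0) f (x 0) ∧ GraphId (x 0) f :=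
  realize_identF x y
theorem rel_p₀ : Rel p₀ x y ↔
    ∃ f g z, Composable (x 0) f g z ∧ ∃ w, IsDom g w ∧ IsPair (y 0) f w := realize_p₀F x y
theorem rel_p₁ : Rel p₁ x y ↔ ∃ f g z, Composable (x 0) f g z ∧ IsPair (y 0) g z :=
  realize_p₁F x y
theorem rel_box : Rel box x y ↔
    ∃ f g z h, Composable (x 0) f g z ∧ IsPair (y 0) h z ∧ GraphComp f g h := realize_boxF x y

end

theorem hom_ext' {A B : ZFCat} {f g : A ⟶ B} (h : ∀ (M : Type) [Nonempty M] [LSet.Structure M]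
    [M ⊨ ZF] (x : Fin A.arity → M) (y y' : Fin B.arity → M), Rel f x y → Rel g x y' → y = y') :
    f = g := by
  refine hom_ext fun M _ _ _ x y hf => ?_
  obtain ⟨y', hg⟩ := Rel.total g hf.holds.1
  rwa [h M x y y' hf hg]

theorem isPullback : IsPullback p₀ p₁ d₁ d₀ := by
  refine isPullback_of_rel (hom_ext' fun M _ _ _ x y y' h h' => eq_of_zero ?_) ?_ ?_
  · obtain ⟨F, h1, h2⟩ := rel_comp.1 h
    obtain ⟨F', h3, h4⟩ := rel_comp.1 h'
    obtain ⟨f, g, z, hc, w, hw, hF⟩ := rel_p₀.1 h1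
    obtain ⟨f', g', z', hc', hF'⟩ := rel_p₁.1 h3
    obtain ⟨rfl, rfl, rfl⟩ := hc.inj hc'
    obtain ⟨f'', h5⟩ := rel_d₁.1 h2
    obtain ⟨g'', z'', h6, h7⟩ := rel_d₀.1 h4
    obtain ⟨rfl, rfl⟩ := pair_inj hF h5.1
    obtain ⟨rfl, rfl⟩ := pair_inj hF' h6.1
    exact dom_unique hw h7
  · intro M _ _ _ a b c h1 h2
    obtain ⟨f, hf⟩ := rel_d₁.1 h1
    obtain ⟨g, z, hg, hd⟩ := rel_d₀.1 h2
    obtain ⟨q, hq⟩ := exists_pair g z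
    obtain ⟨J, hJ⟩ := exists_pair f q
    have hc : Composable J f g z :=
      ⟨⟨q, hq, hJ⟩, hf.2.1, hg.2.1, fun a b hab => (hd b).1 (hf.2.2 a b hab), hg.2.2⟩
    exact ⟨fun _ => J, rel_p₀.2 ⟨f, g, z, hc, _, hd, hf.1⟩, rel_p₁.2 ⟨f, g, z, hc, hg.1⟩⟩
  · intro M _ _ _ a b x x' h1 h2 h3 h4
    refine eq_of_zero ?_
    obtain ⟨f, g, z, hc, w, hw, hF⟩ := rel_p₀.1 h1
    obtain ⟨_, _, _, hc', hF'⟩ := rel_p₁.1 h2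
    obtain ⟨rfl, rfl, rfl⟩ := hc.inj hc'
    obtain ⟨f', g', z', kc, v, hv, kF⟩ := rel_p₀.1 h3
    obtain ⟨_, _, _, kc', kF'⟩ := rel_p₁.1 h4
    obtain ⟨rfl, rfl, rfl⟩ := kc.inj kc'
    obtain ⟨rfl, rfl⟩ := pair_inj hF kF
    obtain ⟨rfl, rfl⟩ := pair_inj hF' kF'
    obtain ⟨⟨q, hq, hx⟩, -⟩ := hc
    obtain ⟨⟨q', hq', hx'⟩, -⟩ := kc
    obtain rfl := pair_unique hq hq'
    exact pair_unique hx hx'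

theorem rel_lift_box {X : ZFCat} {a b : X ⟶ set₁} (hab : a ≫ d₁ = b ≫ d₀)
    {M : Type} [Nonempty M] [LSet.Structure M] [M ⊨ ZF] {x : Fin X.arity → M} {G : Fin 1 → M}
    (h : Rel (isPullback.lift a b hab ≫ box) x G) :
    ∃ (F F' : Fin 1 → M) (f w g z k : M), Rel a x F ∧ Rel b x F' ∧ SetFun (F 0) f w ∧
      SetFun (F' 0) g z ∧ IsDom g w ∧ SetFun (G 0) k z ∧ GraphComp f g k := by
  obtain ⟨J, hJ, hG⟩ := rel_comp.1 h
  obtain ⟨f, g, z, k, hc, hk, hk'⟩ := rel_box.1 hG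
  obtain ⟨F, hF⟩ := Rel.total p₀ hJ.holds.2
  obtain ⟨F', hF'⟩ := Rel.total p₁ hJ.holds.2
  have h1 : Rel a x F := by
    rw [← isPullback.lift_fst a b hab]
    exact rel_comp.2 ⟨J, hJ, hF⟩
  have h2 : Rel b x F' := by
    rw [← isPullback.lift_snd a b hab]
    exact rel_comp.2 ⟨J, hJ, hF'⟩
  obtain ⟨_, _, _, hc', w, hw, hF⟩ := rel_p₀.1 hF
  obtain ⟨rfl, rfl, rfl⟩ := hc.inj hc'
  obtain ⟨_, _, _, hc', hF'⟩ := rel_p₁.1 hF'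
  obtain ⟨rfl, rfl, rfl⟩ := hc.inj hc'
  exact ⟨F, F', f, w, g, z, k, h1, h2, hc.setFun₀ hw hF, hc.setFun₁ hF', hw, hc.setFun hk hk', hk'⟩

end SetCat

open SetCat in
/-- The internal category `SET` of the syntactic category of ZF. -/
def SET : InternalCategory ZFCat where
  C₀ := set₀
  C₁ := set₁
  C₂ := set₂
  d₀ := d₀
  d₁ := d₁
  ident := ident
  p₀ := p₀
  p₁ := p₁
  comp := box
  isPullback := isPullback
  ident_d₀ := by
    refine hom_ext' fun M _ _ _ x y y' h h' => ?_
    obtain ⟨F, h1, h2⟩ := rel_comp.1 h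
    obtain ⟨f, hF, hf⟩ := rel_ident.1 h1
    obtain ⟨f', z, h3, h4⟩ := rel_d₀.1 h2
    obtain ⟨rfl, rfl⟩ := pair_inj hF h3.1
    obtain ⟨-, rfl⟩ := rel_id.1 h'
    refine eq_of_zero (zf_ext fun t => (h4 t).trans ?_)
    simp only [hf.pairMem]
    exact ⟨fun ⟨_, h, _⟩ => h, fun h => ⟨t, h, rfl⟩⟩
  ident_d₁ := by
    refine hom_ext' fun M _ _ _ x y y' h h' => ?_
    obtain ⟨F, h1, h2⟩ := rel_comp.1 h
    obtain ⟨f, hF, hf⟩ := rel_ident.1 h1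
    obtain ⟨f', h3⟩ := rel_d₁.1 h2
    obtain ⟨-, rfl⟩ := rel_id.1 h'
    exact eq_of_zero (pair_inj hF h3.1).2.symm
  comp_d₀ := by
    refine hom_ext' fun M _ _ _ x y y' h h' => ?_
    obtain ⟨F, h1, h2⟩ := rel_comp.1 h
    obtain ⟨F', h3, h4⟩ := rel_comp.1 h'
    obtain ⟨f, g, z, k, hc, hF, hk⟩ := rel_box.1 h1
    obtain ⟨_, _, _, hc', w, hw, hF'⟩ := rel_p₀.1 h3
    obtain ⟨rfl, rfl, rfl⟩ := hc.inj hc'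
    obtain ⟨_, _, h5, h6⟩ := rel_d₀.1 h2
    obtain ⟨rfl, rfl⟩ := pair_inj hF h5.1
    obtain ⟨_, _, h7, h8⟩ := rel_d₀.1 h4
    obtain ⟨rfl, rfl⟩ := pair_inj hF' h7.1
    refine eq_of_zero (zf_ext fun t => (h6 t).trans (Iff.trans ?_ (h8 t).symm))
    simp only [hk.pairMem]
    constructor
    · rintro ⟨_, b, hb, -⟩
      exact ⟨b, hb⟩
    · rintro ⟨b, hb⟩
      obtain ⟨c, hc⟩ := hc.2.2.2.1 _ _ hb
      exact ⟨c, b, hb, hc⟩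
  comp_d₁ := by
    refine hom_ext' fun M _ _ _ x y y' h h' => ?_
    obtain ⟨F, h1, h2⟩ := rel_comp.1 h
    obtain ⟨F', h3, h4⟩ := rel_comp.1 h'
    obtain ⟨f, g, z, k, hc, hF, hk⟩ := rel_box.1 h1
    obtain ⟨_, _, _, hc', hF'⟩ := rel_p₁.1 h3
    obtain ⟨rfl, rfl, rfl⟩ := hc.inj hc'
    obtain ⟨_, h5⟩ := rel_d₁.1 h2
    obtain ⟨_, h7⟩ := rel_d₁.1 h4
    exact eq_of_zero ((pair_inj hF h5.1).2.symm.trans (pair_inj hF' h7.1).2)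
  id_comp := by
    refine hom_ext' fun M _ _ _ x G y h h' => ?_
    obtain ⟨-, rfl⟩ := rel_id.1 h'
    obtain ⟨F, F', f, w, g, z, k, h1, h2, hF, hF', hw, hG, hk⟩ := rel_lift_box _ h
    obtain ⟨-, rfl⟩ := rel_id.1 h2
    obtain ⟨d, h3, h4⟩ := rel_comp.1 h1
    obtain ⟨_, _, h5, h6⟩ := rel_d₀.1 h3
    obtain ⟨rfl, rfl⟩ := hF'.inj h5
    obtain rfl := dom_unique hw h6
    obtain ⟨_, h7, h8⟩ := rel_ident.1 h4
    obtain ⟨rfl, -⟩ := pair_inj hF.1 h7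
    refine eq_of_zero ?_
    obtain rfl : k = g := hG.2.1.ext hF'.2.1 fun a b => by
      simp only [hk.pairMem, h8.pairMem]
      exact ⟨fun ⟨_, ⟨_, e⟩, h⟩ => e ▸ h, fun h => ⟨a, ⟨(hw a).2 ⟨b, h⟩, rfl⟩, h⟩⟩
    exact pair_unique hG.1 hF'.1
  comp_id := by
    refine hom_ext' fun M _ _ _ x G y h h' => ?_
    obtain ⟨-, rfl⟩ := rel_id.1 h'
    obtain ⟨F, F', f, w, g, z, k, h1, h2, hF, hF', hw, hG, hk⟩ := rel_lift_box _ h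
    obtain ⟨-, rfl⟩ := rel_id.1 h1
    obtain ⟨d, h3, h4⟩ := rel_comp.1 h2
    obtain ⟨_, h5⟩ := rel_d₁.1 h3
    obtain ⟨rfl, rfl⟩ := hF.inj h5
    obtain ⟨_, h7, h8⟩ := rel_ident.1 h4
    obtain ⟨rfl, rfl⟩ := pair_inj hF'.1 h7
    refine eq_of_zero ?_
    obtain rfl : k = f := hG.2.1.ext hF.2.1 fun a b => by
      simp only [hk.pairMem, h8.pairMem]
      exact ⟨fun ⟨_, h, _, e⟩ => e ▸ h, fun h => ⟨b, h, hF.2.2 _ _ h, rfl⟩⟩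
    exact pair_unique hG.1 hF.1
  assoc := by
    intro X u v s huv hvs
    refine hom_ext' fun M _ _ _ x G G' h h' => ?_
    obtain ⟨P, S, p, w, g, z, k, h1, h2, hP, hS, -, hG, hk⟩ := rel_lift_box _ h
    obtain ⟨U, V, a, w', b, z', c, h3, h4, hU, hV, -, hP', hc⟩ := rel_lift_box _ h1
    obtain ⟨U', Q, a', v', q, y, k', h5, h6, hU', hQ, -, hG', hk'⟩ := rel_lift_box _ h'
    obtain ⟨V', S', b', w'', g', z'', c', h7, h8, hV', hS', -, hQ', hc'⟩ := rel_lift_box _ h6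
    obtain rfl := h3.unique h5
    obtain rfl := h4.unique h7
    obtain rfl := h2.unique h8
    obtain ⟨rfl, rfl⟩ := hP.inj hP'
    obtain ⟨rfl, rfl⟩ := hQ.inj hQ'
    obtain ⟨rfl, rfl⟩ := hU.inj hU'
    obtain ⟨rfl, rfl⟩ := hV.inj hV'
    obtain ⟨rfl, rfl⟩ := hS.inj hS'
    obtain rfl : k = k' := hG.2.1.ext hG'.2.1 fun i j => by
      simp only [hk.pairMem, hc.pairMem, hk'.pairMem, hc'.pairMem]
      exact ⟨fun ⟨m, ⟨n, h, h'⟩, h''⟩ => ⟨n, h, m, h', h''⟩,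
        fun ⟨n, h, m, h', h''⟩ => ⟨m, ⟨n, h, h'⟩, h''⟩⟩
    exact eq_of_zero (pair_unique hG.1 hG'.1)

/-- The terminal object `{ | ∀ x (x = x)}` of the syntactic category. -/
def one : ZFCat := ⟨0, ∀' (bv 0 ≐ bv 0)⟩

theorem holds_one {M : Type} [LSet.Structure M] (x : Fin 0 → M) : Holds one x := fun _ => rfl

/-- The object `{ | ∀ x (x = x)}` is terminal. -/
noncomputable def oneIsTerminal : Limits.IsTerminal one := by
  have h : ∀ A : ZFCat, IsArrow A one (app A.formula fun i => fv (.inl i)) := by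
    intro A
    rw [isArrow_iff]
    intro M _ _ _
    simp only [realize_app0]
    exact ⟨fun x y h => ⟨h, holds_one y⟩, fun x y y' _ _ => Subsingleton.elim (α := Fin 0 → M) y y',
      fun x h => ⟨(Fin.elim0 : Fin 0 → M), h⟩⟩
  exact Limits.IsTerminal.ofUniqueHom (fun A => Arrow.mk _ (h A)) fun A f =>
    SetCat.hom_ext' fun M _ _ _ x y y' _ _ => Subsingleton.elim (α := Fin 0 → M) y y'

/-- The category `Γ(SET)`. -/
abbrev GammaSET := Gam SET oneIsTerminal

/-! ### The explicit functors -/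

/-- A global element `f : 1 ⟶ {x | R}` is represented by the formula `P(x)`: `f = [{x | P}]`. -/
def Names {R : Fml (Fin 1)} (f : one ⟶ (⟨1, R⟩ : ZFCat)) (P : Fml (Fin 1)) : Prop :=
  Represents f (app P fun i => fv (.inr i))

/-- `∃! x P(x)`. -/
def existsUniqueF (P : Fml (Fin 1)) : Fml Empty :=
  ∃' (app P ![bv 0] ⊓ ∀' (app P ![bv 1] ⟹ (bv 1 ≐ bv 0)))

/-- The formula `∀ x (x ∈ z ↔ P(x))` in the variable `z`. -/
def nameF (P : Fml (Fin 1)) : Fml (Fin 1) := ∀' ((bv 0 ∈' fv 0) ⇔ app P ![bv 0])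

/-- For an arrow `[{x, y | F}]` with codomain `{y | Q}`, the formula
`∃ f ∃ z (f' = ⟨f, z⟩ ∧ ∀ t (t ∈ f ↔ ∃ x ∃ y (t = ⟨x, y⟩ ∧ F(x, y))) ∧ ∀ y (y ∈ z ↔ Q(y)))`
in the variable `f'`. -/
def mapNameF (F : Fml (Fin 1 ⊕ Fin 1)) (Q : Fml (Fin 1)) : Fml (Fin 1) :=
  ∃' ∃' (app pairF ![fv 0, bv 0, bv 1] ⊓
    ((∀' ((bv 2 ∈' bv 0) ⇔ ∃' ∃' (app pairF ![bv 2, bv 3, bv 4] ⊓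
      app F (Sum.elim ![bv 3] ![bv 4])))) ⊓ app (nameF Q) ![bv 1]))

/-- The formula `∃ z (P(z) ∧ x ∈ z)` in the variable `x`. -/
def elemF (P : Fml (Fin 1)) : Fml (Fin 1) := ∃' (app P ![bv 0] ⊓ (fv 0 ∈' bv 0))

/-- The formula `∃ f' (Q(f') ∧ ∃ z ∃ f (f' = ⟨f, z⟩ ∧ ⟨x, x'⟩ ∈ f))` in the variables `x, x'`. -/
def graphF (Q : Fml (Fin 1)) : Fml (Fin 1 ⊕ Fin 1) :=
  ∃' (app Q ![bv 0] ⊓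
    ∃' ∃' (app pairF ![bv 0, bv 2, bv 1] ⊓ app pairMemF ![src, tgt, bv 2]))

/-- The formula `P(x) ∧ x = x'` in the variables `x, x'`. -/
def inclF (P : Fml (Fin 1)) : Fml (Fin 1 ⊕ Fin 1) := app P ![src] ⊓ (src ≐ tgt)

end DefSet

open DefSet

namespace DefSet

/-! ### Representing formulas in models -/

/-! By the completeness theorem, in the forms `entails_iff` and `provable_iff`, every derivability
condition becomes a condition on all models of ZF. In a model, an arrow of the syntactic category is
a total single-valued relation `Rel f`, and arrows with the same relation in every model are equal.
The proof therefore works throughout inside an arbitrary model and never writes a derivation.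

Seen this way, both categories carry the same data. A definable set is a formula whose extension in
each model is the extension of an element of that model, and an arrow is a definable function
between such extensions. A global element of a class has exactly one value `Val` in each model, so
an object of `Γ(SET)` is a uniformly definable set, and an arrow is a uniformly definable pair of a
function and a codomain. The predicates `El` and `Graph`, introduced on each side, extract the
elements and the graph. On both sides identities and composites have the expected graphs
(`graph_id`, `graph_comp`), and parallel arrows with the same graph are equal (`hom_ext`). Once each
functor is known to preserve `El` and `Graph`, functoriality, naturality and the triangle identity
are comparisons of graphs.

Set theory enters in the passage from definable sets to `Γ(SET)`. The extension of a definable set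
is coded by a unique set, by extensionality. The graph of a definable function between definable
sets is a set: it is separated from the double power set of a union (`DST.exists_graph_set`). In the
other direction, the elements of the value of a global element are cut out by a formula, and the
value itself shows that this formula defines a set.

The two composites behave differently. An object of `Γ(SET)` is determined by its elements
(`GammaSET.obj_ext`), so one composite is the identity on the nose. An object of `DST` is a formula,
not a formula up to provable equivalence, so the other composite only gives an isomorphic object;
the isomorphism is the arrow with the graph of the identity (`inclusion`). -/

/-- The conditions on a formula to be an arrow depend only on its extension in models, so a formula
with the extension of `f` inherits them from `f`. This reduces each claim that an explicit formula
represents an arrow to evaluating it. -/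
theorem represents_iff {A B : ZFCat} {f : A ⟶ B} {F : Fml (Fin A.arity ⊕ Fin B.arity)} :
    Represents f F ↔ ∀ (M : Type) [Nonempty M] [LSet.Structure M] [M ⊨ ZF]
      (x : Fin A.arity → M) (y : Fin B.arity → M),
      Formula.Realize F (Sum.elim x y) ↔ Rel f x y := by
  constructor
  · rintro ⟨h, rfl⟩ M _ _ _ x y
    exact Iff.rfl
  · intro h
    have hF : IsArrow A B F := isArrow_iff.2 fun M _ _ _ => by
      simp only [h]
      exact ⟨fun x y h => h.holds, fun x y y' h h' => h.unique h', fun x hx => Rel.total f hx⟩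
    exact ⟨hF, hom_ext fun M _ _ _ x y hxy => (h M x y).2 hxy⟩

theorem exists_represents {A B : ZFCat} (f : A ⟶ B) : ∃ F, Represents f F := by
  obtain ⟨F, hF⟩ := f
  exact ⟨F, hF, rfl⟩

section Val

variable {M : Type} [Nonempty M] [LSet.Structure M] [M ⊨ ZF] {R : Fml (Fin 1)}

/-- The element `a` is the value in the model `M` of the global element `f`. -/
def Val (f : one ⟶ (⟨1, R⟩ : ZFCat)) (a : M) : Prop :=
  Rel f (Fin.elim0 : Fin 0 → M) fun _ => a

/-- The empty context has a single assignment, and an assignment of one variable is determined by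
its entry at `0`. -/
theorem rel_iff_val {f : one ⟶ (⟨1, R⟩ : ZFCat)} {x : Fin 0 → M} {y : Fin 1 → M} :
    Rel f x y ↔ Val f (y 0) := by
  rw [Val, Subsingleton.elim x Fin.elim0, ← eq_of_zero (x := y) (y := fun _ => y 0) rfl]

theorem Val.unique {f : one ⟶ (⟨1, R⟩ : ZFCat)} {a b : M} (h : Val f a) (h' : Val f b) : a = b :=
  congrFun (Rel.unique h h') 0

theorem Val.holds {f : one ⟶ (⟨1, R⟩ : ZFCat)} {a : M} (h : Val f a) :
    Formula.Realize R fun _ => a := (Rel.holds h).2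

variable (M) in
theorem exists_val (f : one ⟶ (⟨1, R⟩ : ZFCat)) : ∃ a : M, Val f a := by
  obtain ⟨y, hy⟩ := Rel.total f (holds_one (Fin.elim0 : Fin 0 → M))
  exact ⟨y 0, rel_iff_val.1 hy⟩

theorem val_comp {S : Fml (Fin 1)} {f : one ⟶ (⟨1, R⟩ : ZFCat)}
    {g : (⟨1, R⟩ : ZFCat) ⟶ (⟨1, S⟩ : ZFCat)} {b : M} :
    Val (f ≫ g) b ↔ ∃ a : M, Val f a ∧ Rel g (fun _ => a) fun _ => b := by
  refine rel_comp.trans ⟨?_, ?_⟩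
  · rintro ⟨y, h, h'⟩
    refine ⟨y 0, rel_iff_val.1 h, ?_⟩
    rwa [← eq_of_zero (x := y) (y := fun _ => y 0) rfl]
  · rintro ⟨a, h, h'⟩
    exact ⟨_, h, h'⟩

end Val

variable {R : Fml (Fin 1)}

/-- One implication is enough, since each global element has exactly one value in each model. -/
theorem val_ext {f g : one ⟶ (⟨1, R⟩ : ZFCat)} (h : ∀ (M : Type) [Nonempty M] [LSet.Structure M]
    [M ⊨ ZF] (a : M), Val f a → Val g a) : f = g :=
  hom_ext fun M _ _ _ _ _ hf => rel_iff_val.2 (h M _ (rel_iff_val.1 hf))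

theorem names_iff {f : one ⟶ (⟨1, R⟩ : ZFCat)} {P : Fml (Fin 1)} :
    Names f P ↔ ∀ (M : Type) [Nonempty M] [LSet.Structure M] [M ⊨ ZF] (a : M),
      (Formula.Realize P fun _ => a) ↔ Val f a := by
  refine represents_iff.trans ⟨fun h M _ _ _ a => ?_, fun h M _ _ _ x y => ?_⟩
  · exact Iff.trans (Iff.symm (realize_app0 P (fun i : Fin 1 => fv (.inr i))
      (Sum.elim (Fin.elim0 : Fin 0 → M) fun _ : Fin 1 => a))) (h M _ _)
  · refine (realize_app0 P _ (Sum.elim x y)).trans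
      (Iff.trans ?_ ((h M (y 0)).trans rel_iff_val.symm))
    rw [← eq_of_zero (x := y) (y := fun _ => y 0) rfl]
    rfl

/-- Existence of a solution gives totality over the one-point context, uniqueness gives
single-valuedness, and the inclusion in `R` puts the value in the target class. -/
theorem exists_names_of {P : Fml (Fin 1)} (h : ∀ (M : Type) [Nonempty M] [LSet.Structure M]
    [M ⊨ ZF], (∃! a : M, Formula.Realize P fun _ => a) ∧
      ∀ a : M, (Formula.Realize P fun _ => a) → Formula.Realize R fun _ => a) :
    ∃ f : one ⟶ (⟨1, R⟩ : ZFCat), Names f P := by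
  have hF : IsArrow one ⟨1, R⟩ (app P fun i => fv (.inr i)) := by
    refine isArrow_iff.2 fun M _ _ _ => ?_
    obtain ⟨⟨a, ha, hu⟩, hR⟩ := h M
    have key : ∀ (x : Fin 0 → M) (y : Fin 1 → M),
        Formula.Realize (app P fun i => fv (.inr i)) (Sum.elim x y) ↔
          Formula.Realize P fun _ => y 0 := by
      intro x y
      rw [realize_app0, ← eq_of_zero (x := y) (y := fun _ => y 0) rfl]
      rfl
    refine ⟨fun x y hy => ⟨holds_one x, ?_⟩, fun x y y' hy hy' => ?_, fun x _ => ?_⟩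
    · have := hR _ ((key x y).1 hy)
      rwa [← eq_of_zero (x := y) (y := fun _ => y 0) rfl] at this
    · exact eq_of_zero ((hu _ ((key x y).1 hy)).trans (hu _ ((key x y').1 hy')).symm)
    · exact ⟨fun _ => a, (key x _).2 ha⟩
  exact ⟨Arrow.mk _ hF, hF, rfl⟩

theorem exists_names (f : one ⟶ (⟨1, R⟩ : ZFCat)) : ∃ P, Names f P := by
  obtain ⟨F, hF⟩ := exists_represents f
  have h := represents_iff.1 hF
  -- The source context is empty, so a formula for the arrow is already a formula in the target
  -- variable alone, up to renaming.
  refine ⟨app F (Sum.elim Fin.elim0 fun i => fv i), names_iff.2 fun M _ _ _ a => ?_⟩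
  refine (realize_app0 F _ _).trans (Iff.trans (iff_of_eq (congrArg _ ?_)) (h M _ _))
  funext x
  rcases x with x | x
  · exact x.elim0
  · rfl

theorem provable_existsUniqueF {P : Fml (Fin 1)} : Provable ZF (existsUniqueF P) ↔
    ∀ (M : Type) [Nonempty M] [LSet.Structure M] [M ⊨ ZF],
      ∃! a : M, Formula.Realize P fun _ => a := by
  rw [provable_iff]
  have key : ∀ (M : Type) [LSet.Structure M] (v : Empty → M),
      Formula.Realize (existsUniqueF P) v ↔ ∃! a : M, Formula.Realize P fun _ => a := by
    intro M _ v
    simp [existsUniqueF, Formula.Realize, realize_app, realize_eqF, Fin.snoc, ExistsUnique,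
      Matrix.cons_fin_one]
  exact ⟨fun h M _ _ _ => (key M Empty.elim).1 (h M _), fun h M _ _ _ v => (key M v).2 (h M)⟩

/-! ### Objects and arrows of `Γ(SET)` in models -/

namespace GammaSET

section

variable {M : Type} [Nonempty M] [LSet.Structure M] [M ⊨ ZF] {X Y Z : GammaSET}

/-- The elements of the value of an object of `Γ(SET)`. -/
def El (X : GammaSET) (a : M) : Prop := ∃ z, Val (R := fv 0 ≐ fv 0) X.name z ∧ E a z

/-- The graph of the value of an arrow of `Γ(SET)`. -/
def Graph (g : X ⟶ Y) (a b : M) : Prop :=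
  ∃ F f z, Val (R := set₁.formula) g.name F ∧ SetFun F f z ∧ PairMem a b f

theorem el_iff {z : M} (h : Val (R := fv 0 ≐ fv 0) X.name z) (a : M) : El X a ↔ E a z :=
  ⟨fun ⟨_, h', ha⟩ => h.unique h' ▸ ha, fun ha => ⟨z, h, ha⟩⟩

/-- Values are unique and Kuratowski pairs are injective, so the existential quantifiers in `Graph`
may be evaluated at any witnesses at hand. -/
theorem graph_iff {g : X ⟶ Y} {F f z : M} (h : Val (R := set₁.formula) g.name F)
    (hF : SetFun F f z) (a b : M) : Graph g a b ↔ PairMem a b f := by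
  constructor
  · rintro ⟨F', f', z', h', hF', hab⟩
    obtain rfl := h.unique h'
    obtain ⟨rfl, rfl⟩ := hF.inj hF'
    exact hab
  · exact fun hab => ⟨F, f, z, h, hF, hab⟩

variable (M) in
-- Collects everything a model knows about an arrow of `Γ(SET)`. The later facts about `Graph` are
-- read off from these witnesses.
theorem exists_setFun (g : X ⟶ Y) : ∃ F f z d : M, Val (R := set₁.formula) g.name F ∧
    SetFun F f z ∧ IsDom f d ∧ Val (R := fv 0 ≐ fv 0) X.name d ∧
    Val (R := fv 0 ≐ fv 0) Y.name z := by
  obtain ⟨d, hd⟩ := exists_val M (R := fv 0 ≐ fv 0) X.name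
  obtain ⟨z, hz⟩ := exists_val M (R := fv 0 ≐ fv 0) Y.name
  have hd' := hd
  have hz' := hz
  -- The values of `X` and `Y` become values of `g.name` followed by the domain and codomain maps,
  -- so both are computed from the one value of `g.name`.
  rw [← g.dom] at hd'
  rw [← g.cod] at hz'
  obtain ⟨F, hF, h⟩ := (val_comp (R := set₁.formula)).1 hd'
  obtain ⟨F', hF', h'⟩ := (val_comp (R := set₁.formula)).1 hz'
  obtain rfl := hF.unique hF'
  obtain ⟨f, z', h1, h2⟩ := SetCat.rel_d₀.1 h
  obtain ⟨f', h3⟩ := SetCat.rel_d₁.1 h'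
  obtain ⟨rfl, rfl⟩ := h1.inj h3
  exact ⟨F, f, _, d, hF, h1, h2, hd, hz⟩

theorem Graph.el {g : X ⟶ Y} {a b : M} (h : Graph g a b) : El X a ∧ El Y b := by
  obtain ⟨F, f, z, d, hF, hf, hfd, hd, hz⟩ := exists_setFun M g
  rw [graph_iff hF hf] at h
  rw [el_iff hd, el_iff hz]
  exact ⟨(hfd a).2 ⟨b, h⟩, hf.2.2 a b h⟩

theorem Graph.unique {g : X ⟶ Y} {a b b' : M} (h : Graph g a b) (h' : Graph g a b') : b = b' := by
  obtain ⟨F, f, z, d, hF, hf, -⟩ := exists_setFun M g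
  rw [graph_iff hF hf] at h h'
  exact hf.2.1.2 a b b' ⟨h, h'⟩

theorem exists_graph (g : X ⟶ Y) {a : M} (h : El X a) : ∃ b, Graph g a b := by
  obtain ⟨F, f, z, d, hF, hf, hfd, hd, hz⟩ := exists_setFun M g
  simp only [graph_iff hF hf]
  exact (hfd a).1 ((el_iff hd a).1 h)

theorem graph_id {a b : M} : Graph (𝟙 X) a b ↔ El X a ∧ a = b := by
  obtain ⟨F, f, z, d, hF, hf, -⟩ := exists_setFun M (𝟙 X)
  rw [graph_iff hF hf]
  -- The identity of `X` in `Γ(SET)` is by definition its name followed by the internal identity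
  -- map.
  have hF' : Val (R := set₁.formula) (X.name ≫ SetCat.ident) F := hF
  obtain ⟨x, hx, h⟩ := (val_comp (R := fv 0 ≐ fv 0)).1 hF'
  obtain ⟨f', h1, h2⟩ := SetCat.rel_ident.1 h
  obtain ⟨rfl, rfl⟩ := pair_inj hf.1 h1
  rw [h2.pairMem, el_iff hx]

theorem graph_comp {g : X ⟶ Y} {h : Y ⟶ Z} {a c : M} :
    Graph (g ≫ h) a c ↔ ∃ b, Graph g a b ∧ Graph h b c := by
  obtain ⟨K, hK⟩ := exists_val M (R := set₁.formula) (g ≫ h).name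
  -- Composition in `Γ(SET)` is by definition the lift to composable pairs followed by the internal
  -- composition, which `SetCat.rel_lift_box` evaluates.
  have hK' : Rel (SetCat.isPullback.lift g.name h.name (g.cod.trans h.dom.symm) ≫ SetCat.box)
    (Fin.elim0 : Fin 0 → M) fun _ => K := hK
  obtain ⟨F, F', f, w, f', z, k, h1, h2, h3, h4, -, h5, h6⟩ := SetCat.rel_lift_box _ hK'
  rw [graph_iff hK h5, h6.pairMem]
  simp only [graph_iff (rel_iff_val.1 h1) h3, graph_iff (rel_iff_val.1 h2) h4]

end

/-- Extensionality holds in each model, so equal elements force equal values, hence equal global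
elements. This is what makes one composite of the functors strictly the identity on objects. -/
theorem obj_ext {X Y : GammaSET} (h : ∀ (M : Type) [Nonempty M] [LSet.Structure M] [M ⊨ ZF]
    (a : M), El X a ↔ El Y a) : X = Y := by
  obtain ⟨f⟩ := X
  obtain ⟨g⟩ := Y
  congr 1
  refine val_ext (R := fv 0 ≐ fv 0) fun M _ _ _ a ha => ?_
  obtain ⟨b, hb⟩ := exists_val M (R := fv 0 ≐ fv 0) g
  obtain rfl : a = b := zf_ext fun t => by
    have := h M t
    rwa [el_iff ha, el_iff hb] at this
  exact hb

/-- The value of an arrow is a pair of a function and a codomain. The graph determines the function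
but says nothing about the codomain, which agrees because both arrows have target `Y`. -/
theorem hom_ext {X Y : GammaSET} {g h : X ⟶ Y} (H : ∀ (M : Type) [Nonempty M] [LSet.Structure M]
    [M ⊨ ZF] (a b : M), Graph g a b ↔ Graph h a b) : g = h := by
  refine Gam.Hom.ext (val_ext (R := set₁.formula) fun M _ _ _ F hF => ?_)
  obtain ⟨F, f, z, -, h1, h2, -, -, h3⟩ := exists_setFun M g
  obtain rfl := hF.unique h1
  obtain ⟨F', f', z', -, h4, h5, -, -, h6⟩ := exists_setFun M h
  obtain rfl := h3.unique h6
  obtain rfl : f = f' := h2.2.1.ext h5.2.1 fun a b => by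
    rw [← graph_iff h1 h2, ← graph_iff h4 h5, H]
  rwa [pair_unique h2.1 h5.1]

/-- Transport along an equality of objects does not affect graphs. This and the next lemma absorb
the transports that appear when functors are compared by equality. -/
theorem graph_eqToHom_comp {X X' Y : GammaSET} (e : X = X') (g : X' ⟶ Y) {M : Type} [Nonempty M]
    [LSet.Structure M] [M ⊨ ZF] {a b : M} : Graph (eqToHom e ≫ g) a b ↔ Graph g a b := by
  subst e
  simp

theorem graph_comp_eqToHom {X Y Y' : GammaSET} (g : X ⟶ Y) (e : Y = Y') {M : Type} [Nonempty M]
    [LSet.Structure M] [M ⊨ ZF] {a b : M} : Graph (g ≫ eqToHom e) a b ↔ Graph g a b := by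
  subst e
  simp

end GammaSET

/-! ### Definable sets in models -/

theorem isDefSet_iff {A : DCL} : IsDefSet A ↔ ∀ (M : Type) [Nonempty M] [LSet.Structure M]
    [M ⊨ ZF], ∃ z : M, ∀ a, E a z ↔ Formula.Realize (DefClass.formula A) fun _ => a := by
  refine (provable_iff (α := Empty)).trans ?_
  have key : ∀ (M : Type) [LSet.Structure M] (v : Empty → M),
      Formula.Realize (∃' ∀' ((bv 1 ∈' bv 0) ⇔ app (DefClass.formula A) ![bv 1])) v ↔
        ∃ z : M, ∀ a, E a z ↔ Formula.Realize (DefClass.formula A) fun _ => a := by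
    intro M _ v
    simp [Formula.Realize, realize_app, realize_memF, Fin.snoc, Matrix.cons_fin_one]
  exact ⟨fun h M _ _ _ => (key M Empty.elim).1 (h M _), fun h M _ _ _ v => (key M v).2 (h M)⟩

namespace DST

section

variable {M : Type} [Nonempty M] [LSet.Structure M] [M ⊨ ZF] {A B C : DST}

/-- The elements of a definable set in a model. -/
def El (A : DST) (a : M) : Prop := Formula.Realize A.formula fun _ => a

variable (M) in
theorem exists_set (A : DST) : ∃ z : M, ∀ a, E a z ↔ El A a := isDefSet_iff.1 A.property M

/-- The graph of an arrow of definable sets in a model. -/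
def Graph (f : A ⟶ B) (a b : M) : Prop := Rel (arrow f) (fun _ => a) fun _ => b

theorem Graph.el {f : A ⟶ B} {a b : M} (h : Graph f a b) : El A a ∧ El B b := Rel.holds h

theorem Graph.unique {f : A ⟶ B} {a b b' : M} (h : Graph f a b) (h' : Graph f a b') : b = b' :=
  congrFun (Rel.unique h h') 0

theorem rel_iff_graph {f : A ⟶ B} {x y : Fin 1 → M} : Rel (arrow f) x y ↔ Graph f (x 0) (y 0) := by
  rw [Graph, ← eq_of_zero (x := x) (y := fun _ => x 0) rfl,
    ← eq_of_zero (x := y) (y := fun _ => y 0) rfl]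

theorem exists_graph (f : A ⟶ B) {a : M} (h : El A a) : ∃ b, Graph f a b := by
  obtain ⟨y, hy⟩ := Rel.total (arrow f) h
  exact ⟨y 0, rel_iff_graph.1 hy⟩

theorem graph_id {a b : M} : Graph (𝟙 A) a b ↔ El A a ∧ a = b :=
  (rel_id (A := A.toZFCat)).trans (and_congr Iff.rfl ⟨fun h => congrFun h 0, fun h => h ▸ rfl⟩)

theorem graph_comp {f : A ⟶ B} {g : B ⟶ C} {a c : M} :
    Graph (f ≫ g) a c ↔ ∃ b, Graph f a b ∧ Graph g b c := by
  refine (rel_comp (f := arrow f) (g := arrow g)).trans ⟨?_, ?_⟩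
  · rintro ⟨y, h, h'⟩
    exact ⟨y 0, rel_iff_graph.1 h, rel_iff_graph.1 h'⟩
  · rintro ⟨b, h, h'⟩
    exact ⟨_, h, h'⟩

end

/-- Inclusion of graphs suffices because both are graphs of total functions on the same extension.
-/
theorem hom_ext {A B : DST} {f g : A ⟶ B} (h : ∀ (M : Type) [Nonempty M] [LSet.Structure M]
    [M ⊨ ZF] (a b : M), Graph f a b → Graph g a b) : f = g := by
  refine ObjectProperty.hom_ext _ (InducedCategory.hom_ext ?_)
  exact DefSet.hom_ext fun M _ _ _ x y hf => rel_iff_graph.2 (h M _ _ (rel_iff_graph.1 hf))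

theorem represents_iff {A B : DST} {f : A ⟶ B} {F : Fml (Fin 1 ⊕ Fin 1)} :
    Represents (arrow f) F ↔ ∀ (M : Type) [Nonempty M] [LSet.Structure M] [M ⊨ ZF] (a b : M),
      Formula.Realize F (Sum.elim (fun _ => a) fun _ => b) ↔ Graph f a b := by
  refine DefSet.represents_iff.trans ⟨fun h M _ _ _ a b => h M _ _, fun h M _ _ _ x y => ?_⟩
  rw [rel_iff_graph, ← h, ← eq_of_zero (x := x) (y := fun _ => x 0) rfl,
    ← eq_of_zero (x := y) (y := fun _ => y 0) rfl]

theorem exists_arrow {A B : DST} (F : Fml (Fin 1 ⊕ Fin 1))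
    (h : ∀ (M : Type) [Nonempty M] [LSet.Structure M] [M ⊨ ZF],
      (∀ a b : M, Formula.Realize F (Sum.elim (fun _ => a) fun _ => b) → El A a ∧ El B b) ∧
      (∀ a b b' : M, Formula.Realize F (Sum.elim (fun _ => a) fun _ => b) →
        Formula.Realize F (Sum.elim (fun _ => a) fun _ => b') → b = b') ∧
      ∀ a : M, El A a → ∃ b : M, Formula.Realize F (Sum.elim (fun _ => a) fun _ => b)) :
    ∃ f : A ⟶ B, Represents (arrow f) F := by
  have e : ∀ {M : Type} (x : Fin 1 → M), x = fun _ => x 0 := fun x => eq_of_zero rfl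
  have hF : IsArrow A.toZFCat B.toZFCat F := by
    refine isArrow_one fun M _ _ _ => ?_
    obtain ⟨h1, h2, h3⟩ := h M
    refine ⟨fun x y hxy => ?_, fun x y y' hy hy' => ?_, fun x hx => ?_⟩
    · rw [e x, e y] at hxy ⊢
      exact h1 _ _ hxy
    · rw [e x, e y] at hy
      rw [e x, e y'] at hy'
      exact h2 _ _ _ hy hy'
    · rw [e x] at hx ⊢
      exact h3 _ hx
  -- The nested brackets wrap the syntactic arrow as an arrow of `DCL` and then of its full
  -- subcategory.
  exact ⟨⟨⟨Arrow.mk F hF⟩⟩, hF, rfl⟩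

end DST

/-! ### The explicit formulas of the theorem, evaluated in a model -/

section Realize

variable {M : Type} [LSet.Structure M] {P Q : Fml (Fin 1)} {F : Fml (Fin 1 ⊕ Fin 1)} {a b : M}

theorem realize_nameF : (Formula.Realize (nameF P) fun _ => a) ↔
    ∀ x, E x a ↔ Formula.Realize P fun _ => x := by
  simp [nameF, Formula.Realize, realize_app, realize_memF, Fin.snoc, Matrix.cons_fin_one]

theorem realize_elemF : (Formula.Realize (elemF P) fun _ => a) ↔
    ∃ z, (Formula.Realize P fun _ => z) ∧ E a z := by
  simp [elemF, Formula.Realize, realize_app, realize_memF, Fin.snoc, Matrix.cons_fin_one]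

theorem realize_inclF : Formula.Realize (inclF P) (Sum.elim (fun _ => a) fun _ => b) ↔
    (Formula.Realize P fun _ => a) ∧ a = b := by
  simp [inclF, Formula.Realize, realize_app, realize_eqF, Matrix.cons_fin_one]

theorem realize_graphF : Formula.Realize (graphF Q) (Sum.elim (fun _ => a) fun _ => b) ↔
    ∃ c, (Formula.Realize Q fun _ => c) ∧ ∃ z f, IsPair c f z ∧ PairMem a b f := by
  -- Substitution is unfolded only for `Q`, so that the instances of `pairF` and `pairMemF` remain
  -- available to their own evaluation lemmas.
  simp [graphF, Formula.Realize, realize_app Q, realize_pairF, realize_pairMemF, Fin.snoc,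
    Matrix.cons_fin_one]

theorem realize_mapNameF : (Formula.Realize (mapNameF F Q) fun _ => a) ↔
    ∃ f z, IsPair a f z ∧
      (∀ t, E t f ↔ ∃ x y, IsPair t x y ∧ Formula.Realize F (Sum.elim (fun _ => x) fun _ => y)) ∧
      ∀ y, E y z ↔ Formula.Realize Q fun _ => y := by
  simp [mapNameF, Formula.Realize, realize_app F, realize_app (nameF Q), realize_pairF,
    realize_memF, Fin.snoc, Matrix.cons_fin_one]
  -- What remains is that two assignments of the variables of `F` coincide, which is checked on each
  -- summand, and the evaluation of `nameF Q`.
  refine exists_congr fun f => exists_congr fun z => and_congr Iff.rfl (and_congr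
    (forall_congr' fun t => iff_congr Iff.rfl (exists_congr fun x => exists_congr fun y =>
      and_congr Iff.rfl (iff_of_eq (congrArg (BoundedFormula.Realize F · default) ?_))))
    realize_nameF)
  funext i
  rcases i with i | i <;> rfl

end Realize

/-! ### The functor from definable sets to global elements -/

/-- Being a definable set says that the name has a solution in each model, and extensionality says
that it has only one. -/
theorem exists_obj_names (A : DST) : ∃ X : GammaSET, Names X.name (nameF A.formula) := by
  obtain ⟨f, hf⟩ := exists_names_of (R := fv 0 ≐ fv 0) (P := nameF A.formula) fun M _ _ _ => by
    simp only [realize_nameF]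
    obtain ⟨z, hz⟩ := DST.exists_set M A
    exact ⟨⟨z, hz, fun y hy => zf_ext fun t => (hy t).trans (hz t).symm⟩, fun _ _ => rfl⟩
  exact ⟨⟨f⟩, hf⟩

section

variable {M : Type} [Nonempty M] [LSet.Structure M] [M ⊨ ZF] {A B : DST}

theorem el_of_names {X : GammaSET} (hX : Names X.name (nameF A.formula)) (a : M) :
    GammaSET.El X a ↔ DST.El A a := by
  obtain ⟨z, hz⟩ := exists_val M (R := fv 0 ≐ fv 0) X.name
  rw [GammaSET.el_iff hz]
  exact realize_nameF.1 ((names_iff.1 hX M z).2 hz) a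

variable (M) in
-- The source and target are sets `u` and `v`, so the Kuratowski pairs in the graph all belong to
-- the double power set of `u ∪ v`, and separation cuts out the graph. Replacement is not needed.
theorem DST.exists_graph_set (f : A ⟶ B) :
    ∃ φ : M, ∀ t, E t φ ↔ ∃ x y, IsPair t x y ∧ Graph f x y := by
  -- Separation is a schema, so it has to be applied to an actual formula for the graph; no
  -- parameters occur in it, whence `k := 0` below.
  obtain ⟨F, hF⟩ := exists_represents (arrow f)
  have hF' := DST.represents_iff.1 hF
  obtain ⟨u, hu⟩ := exists_set M A
  obtain ⟨v, hv⟩ := exists_set M B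
  obtain ⟨c, hc⟩ := zf_pair u v
  obtain ⟨s, hs⟩ := zf_union c
  obtain ⟨w, hw⟩ := exists_square s
  obtain ⟨φ, hφ⟩ := zf_sep (k := 0) (∃' ∃' (app pairF ![fv (.inr 0), bv 0, bv 1] ⊓
    app F (Sum.elim (fun _ => bv 0) fun _ => bv 1))) Fin.elim0 w
  refine ⟨φ, fun t => (hφ t).trans ?_⟩
  have : Formula.Realize (∃' ∃' (app pairF ![fv (.inr 0), bv 0, bv 1] ⊓
      app F (Sum.elim (fun _ => bv 0) fun _ => bv 1)) : Fml (Fin 0 ⊕ Fin 1))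
        (Sum.elim Fin.elim0 fun _ => t) ↔ ∃ x y, IsPair t x y ∧ Graph f x y := by
    simp only [← hF']
    simp [Formula.Realize, realize_app F, realize_pairF, Fin.snoc]
    refine exists_congr fun x => exists_congr fun y => and_congr Iff.rfl
      (iff_of_eq (congrArg (BoundedFormula.Realize F · default) ?_))
    funext i
    rcases i with i | i <;> rfl
  rw [this]
  refine ⟨fun h => h.2, fun ⟨x, y, h, h'⟩ => ⟨hw x y t ?_ ?_ h, x, y, h, h'⟩⟩
  · exact (hs x).2 ⟨u, (hu x).2 h'.el.1, (hc u).2 (Or.inl rfl)⟩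
  · exact (hs y).2 ⟨v, (hv y).2 h'.el.2, (hc v).2 (Or.inr rfl)⟩

theorem DST.pairMem_graph {f : A ⟶ B} {φ : M}
    (h : ∀ t, E t φ ↔ ∃ x y, IsPair t x y ∧ Graph f x y) (a b : M) :
    PairMem a b φ ↔ Graph f a b := by
  constructor
  · rintro ⟨p, hp, hpφ⟩
    obtain ⟨x, y, hxy, hf⟩ := (h p).1 hpφ
    obtain ⟨rfl, rfl⟩ := pair_inj hp hxy
    exact hf
  · intro hf
    obtain ⟨p, hp⟩ := exists_pair a b
    exact ⟨p, hp, (h p).2 ⟨a, b, hp, hf⟩⟩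

theorem DST.setFun_graph {f : A ⟶ B} {φ z p : M}
    (h : ∀ t, E t φ ↔ ∃ x y, IsPair t x y ∧ Graph f x y) (hz : ∀ y, E y z ↔ El B y)
    (hp : IsPair p φ z) : SetFun p φ z := by
  refine ⟨hp, ⟨fun t ht => ?_, fun a b b' hab => ?_⟩, fun a b hab => ?_⟩
  · obtain ⟨x, y, hxy, -⟩ := (h t).1 ht
    exact ⟨x, y, hxy⟩
  · rw [pairMem_graph h, pairMem_graph h] at hab
    exact hab.1.unique hab.2
  · exact (hz b).2 ((pairMem_graph h a b).1 hab).el.2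

/-- The formula `mapNameF` does not ask that its first component be a function into its second. For
an arrow of definable sets this comes for free, from single-valuedness and the target of `f`. -/
theorem realize_mapNameF_iff {f : A ⟶ B} {F : Fml (Fin 1 ⊕ Fin 1)}
    (hF : Represents (DST.arrow f) F) {p : M} :
    (Formula.Realize (mapNameF F B.formula) fun _ => p) ↔ ∃ φ z, SetFun p φ z ∧
      (∀ t, E t φ ↔ ∃ x y, IsPair t x y ∧ DST.Graph f x y) ∧ ∀ y, E y z ↔ DST.El B y := by
  rw [realize_mapNameF]
  simp only [DST.represents_iff.1 hF M]
  exact exists_congr fun φ => exists_congr fun z =>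
    ⟨fun ⟨h, h', h''⟩ => ⟨DST.setFun_graph h' h'' h, h', h''⟩, fun ⟨h, h'⟩ => ⟨h.1, h'⟩⟩

theorem graph_of_names {X Y : GammaSET} {g : X ⟶ Y} {f : A ⟶ B} {F : Fml (Fin 1 ⊕ Fin 1)}
    (hF : Represents (DST.arrow f) F) (hg : Names g.name (mapNameF F B.formula)) (a b : M) :
    GammaSET.Graph g a b ↔ DST.Graph f a b := by
  obtain ⟨p, hp⟩ := exists_val M (R := set₁.formula) g.name
  obtain ⟨φ, z, h, h', -⟩ := (realize_mapNameF_iff hF).1 ((names_iff.1 hg M p).2 hp)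
  rw [GammaSET.graph_iff hp h, DST.pairMem_graph h']

end

/-- Stated for arbitrary `X` and `Y` with the right names and for an arbitrary representing `F`, so
that it serves both to construct the functor and, through `names_map`, to prove its formula for
every representative. -/
theorem exists_hom_names {A B : DST} {X Y : GammaSET} (hX : Names X.name (nameF A.formula))
    (hY : Names Y.name (nameF B.formula)) {f : A ⟶ B} {F : Fml (Fin 1 ⊕ Fin 1)}
    (hF : Represents (DST.arrow f) F) : ∃ g : X ⟶ Y, Names g.name (mapNameF F B.formula) := by
  obtain ⟨g, hg⟩ := exists_names_of (R := set₁.formula) (P := mapNameF F B.formula)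
    fun M _ _ _ => by
      simp only [realize_mapNameF_iff hF]
      refine ⟨?_, fun p ⟨φ, z, h, _⟩ => (holds_set₁ _).2 ⟨φ, z, h⟩⟩
      obtain ⟨φ, hφ⟩ := DST.exists_graph_set M f
      obtain ⟨z, hz⟩ := DST.exists_set M B
      obtain ⟨p, hp⟩ := exists_pair φ z
      refine ⟨p, ⟨φ, z, DST.setFun_graph hφ hz hp, hφ, hz⟩, ?_⟩
      rintro p' ⟨φ', z', h, hφ', hz'⟩
      obtain rfl : φ = φ' := zf_ext fun t => (hφ t).trans (hφ' t).symm
      obtain rfl : z = z' := zf_ext fun t => (hz t).trans (hz' t).symm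
      exact pair_unique h.1 hp
  have hg' := names_iff.1 hg
  refine ⟨⟨g, val_ext (R := fv 0 ≐ fv 0) fun M _ _ _ x hx => ?_,
    val_ext (R := fv 0 ≐ fv 0) fun M _ _ _ x hx => ?_⟩, hg⟩ <;>
  obtain ⟨p, hp, h⟩ := (val_comp (R := set₁.formula)).1 hx <;>
  obtain ⟨φ, z, h1, h2, h3⟩ := (realize_mapNameF_iff hF).1 ((hg' M p).2 hp)
  · obtain ⟨φ', z', h4, h5⟩ := SetCat.rel_d₀.1 h
    obtain ⟨rfl, rfl⟩ := h1.inj h4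
    -- The domain of the graph is the extension of `A`: one inclusion holds because the graph
    -- relates only elements of `A`, the other because `f` is total.
    refine (names_iff.1 hX M x).1 (realize_nameF.2 fun a => (h5 a).trans ?_)
    simp only [DST.pairMem_graph h2]
    exact ⟨fun ⟨b, hb⟩ => hb.el.1, DST.exists_graph f⟩
  · obtain ⟨φ', h4⟩ := SetCat.rel_d₁.1 h
    obtain ⟨rfl, rfl⟩ := h1.inj h4
    exact (names_iff.1 hY M _).1 (realize_nameF.2 h3)

/-- Any arrow with the graph of `f` equals the one named by `mapNameF F`, because graphs determine
arrows. Hence the choices made in defining the functor do not matter. -/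
theorem names_map {A B : DST} {X Y : GammaSET} (hX : Names X.name (nameF A.formula))
    (hY : Names Y.name (nameF B.formula)) {g : X ⟶ Y} {f : A ⟶ B}
    (h : ∀ (M : Type) [Nonempty M] [LSet.Structure M] [M ⊨ ZF] (a b : M),
      GammaSET.Graph g a b ↔ DST.Graph f a b)
    {F : Fml (Fin 1 ⊕ Fin 1)} (hF : Represents (DST.arrow f) F) :
    Names g.name (mapNameF F B.formula) := by
  obtain ⟨g', hg'⟩ := exists_hom_names hX hY hF
  obtain rfl : g = g' := GammaSET.hom_ext fun M _ _ _ a b =>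
    (h M a b).trans (graph_of_names hF hg' a b).symm
  exact hg'

/-- The object of `Γ(SET)` given by a definable set. -/
noncomputable def toGammaObj (A : DST) : GammaSET := (exists_obj_names A).choose

theorem names_toGammaObj (A : DST) : Names (toGammaObj A).name (nameF A.formula) :=
  (exists_obj_names A).choose_spec

/-- The representative `F` is forgotten here: the graph alone characterizes the arrow, and
functoriality then follows from the graphs of identities and composites. -/
theorem exists_toGammaMap {A B : DST} (f : A ⟶ B) : ∃ g : toGammaObj A ⟶ toGammaObj B,
    ∀ (M : Type) [Nonempty M] [LSet.Structure M] [M ⊨ ZF] (a b : M),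
      GammaSET.Graph g a b ↔ DST.Graph f a b := by
  obtain ⟨F, hF⟩ := exists_represents (DST.arrow f)
  obtain ⟨g, hg⟩ := exists_hom_names (names_toGammaObj A) (names_toGammaObj B) hF
  exact ⟨g, fun M _ _ _ a b => graph_of_names hF hg a b⟩

/-- The arrow of `Γ(SET)` given by an arrow of definable sets. -/
noncomputable def toGammaMap {A B : DST} (f : A ⟶ B) : toGammaObj A ⟶ toGammaObj B :=
  (exists_toGammaMap f).choose

section

variable {M : Type} [Nonempty M] [LSet.Structure M] [M ⊨ ZF] {A B : DST}

theorem el_toGammaObj {a : M} : GammaSET.El (toGammaObj A) a ↔ DST.El A a :=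
  el_of_names (names_toGammaObj A) a

theorem graph_toGammaMap {f : A ⟶ B} {a b : M} :
    GammaSET.Graph (toGammaMap f) a b ↔ DST.Graph f a b :=
  (exists_toGammaMap f).choose_spec M a b

end

/-- The functor `DST[ZF] ⥤ Γ(SET)`. -/
noncomputable def toGamma : DST ⥤ GammaSET where
  obj := toGammaObj
  map := toGammaMap
  map_id A := GammaSET.hom_ext fun M _ _ _ a b => by
    rw [graph_toGammaMap, DST.graph_id, GammaSET.graph_id, el_toGammaObj]
  map_comp f g := GammaSET.hom_ext fun M _ _ _ a b => by
    simp only [graph_toGammaMap, DST.graph_comp, GammaSET.graph_comp]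

/-! ### The functor from global elements to definable sets -/

theorem realize_elemF_rep {rep : GammaSET → Fml (Fin 1)} (hrep : ∀ X, Names X.name (rep X))
    (X : GammaSET) {M : Type} [Nonempty M] [LSet.Structure M] [M ⊨ ZF] (a : M) :
    (Formula.Realize (elemF (rep X)) fun _ => a) ↔ GammaSET.El X a := by
  -- The chosen formula holds exactly of the value of `X`, which turns the formula into the
  -- definition of `GammaSET.El`. The choice of `rep` thus leaves no trace on elements.
  simp only [realize_elemF, names_iff.1 (hrep X) M]
  rfl

section OfGamma

variable {rep : GammaSET → Fml (Fin 1)} (hrep : ∀ X, Names X.name (rep X))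

/-- The definable set given by an object of `Γ(SET)`. -/
def ofGammaObj (X : GammaSET) : DST :=
  ⟨⟨elemF (rep X)⟩, isDefSet_iff.2 fun M _ _ _ => by
    -- The value of `X` in the model is itself the set required by definability.
    obtain ⟨z, hz⟩ := exists_val M (R := fv 0 ≐ fv 0) X.name
    exact ⟨z, fun a => (GammaSET.el_iff hz a).symm.trans (realize_elemF_rep hrep X a).symm⟩⟩

theorem el_ofGammaObj {X : GammaSET} {M : Type} [Nonempty M] [LSet.Structure M] [M ⊨ ZF]
    {a : M} : DST.El (ofGammaObj hrep X) a ↔ GammaSET.El X a := realize_elemF_rep hrep X a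

theorem realize_graphF_iff {X Y : GammaSET} {g : X ⟶ Y} {Q : Fml (Fin 1)} (hQ : Names g.name Q)
    {M : Type} [Nonempty M] [LSet.Structure M] [M ⊨ ZF] {a b : M} :
    Formula.Realize (graphF Q) (Sum.elim (fun _ => a) fun _ => b) ↔ GammaSET.Graph g a b := by
  simp only [realize_graphF, names_iff.1 hQ M]
  constructor
  · rintro ⟨c, hc, z, f, hp, hab⟩
    -- The formula `graphF` only decomposes the value as a pair. That the components are a function
    -- and a codomain follows because the value lies in `set₁`, and pairs are injective.
    obtain ⟨f', z', h⟩ := (holds_set₁ _).1 hc.holds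
    obtain ⟨rfl, rfl⟩ := pair_inj hp h.1
    exact ⟨c, f, z, hc, h, hab⟩
  · rintro ⟨c, f, z, hc, h, hab⟩
    exact ⟨c, hc, z, f, h.1, hab⟩

/-- The graph of `g` is functional on the elements of its source, since the value of `g` is a
function whose domain is the value of `X`. A formula naming `g` makes this graph definable. -/
theorem exists_ofGammaMap {X Y : GammaSET} (g : X ⟶ Y) :
    ∃ f : ofGammaObj hrep X ⟶ ofGammaObj hrep Y,
      ∀ (M : Type) [Nonempty M] [LSet.Structure M] [M ⊨ ZF] (a b : M),
        DST.Graph f a b ↔ GammaSET.Graph g a b := by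
  obtain ⟨Q, hQ⟩ := exists_names (R := set₁.formula) g.name
  obtain ⟨f, hf⟩ := DST.exists_arrow (A := ofGammaObj hrep X) (B := ofGammaObj hrep Y) (graphF Q)
    fun M _ _ _ => by
      simp only [realize_graphF_iff hQ, el_ofGammaObj]
      exact ⟨fun _ _ h => h.el, fun _ _ _ h h' => h.unique h',
        fun _ h => GammaSET.exists_graph g h⟩
  exact ⟨f, fun M _ _ _ a b =>
    (DST.represents_iff.1 hf M a b).symm.trans (realize_graphF_iff hQ)⟩

/-- The arrow of definable sets given by an arrow of `Γ(SET)`. -/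
noncomputable def ofGammaMap {X Y : GammaSET} (g : X ⟶ Y) :
    ofGammaObj hrep X ⟶ ofGammaObj hrep Y :=
  (exists_ofGammaMap hrep g).choose

theorem graph_ofGammaMap {X Y : GammaSET} {g : X ⟶ Y} {M : Type} [Nonempty M]
    [LSet.Structure M] [M ⊨ ZF] {a b : M} :
    DST.Graph (ofGammaMap hrep g) a b ↔ GammaSET.Graph g a b :=
  (exists_ofGammaMap hrep g).choose_spec M a b

/-- The functor `Γ(SET) ⥤ DST[ZF]` given by a choice of representing formulas. -/
noncomputable def ofGamma : GammaSET ⥤ DST where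
  obj := ofGammaObj hrep
  map := ofGammaMap hrep
  map_id X := DST.hom_ext fun M _ _ _ a b => by
    rw [graph_ofGammaMap, DST.graph_id, GammaSET.graph_id, el_ofGammaObj]
    exact id
  map_comp f g := DST.hom_ext fun M _ _ _ a b => by
    simp only [graph_ofGammaMap, DST.graph_comp, GammaSET.graph_comp]
    exact id

/-! ### The equivalence -/

/-- Formulas with the same extension in all models may still be different objects of `DST`. This
arrow, whose graph is the identity, compares them, and the arrow in the other direction is its
inverse. -/
theorem exists_inclusion {A B : DST} (h : ∀ (M : Type) [Nonempty M] [LSet.Structure M] [M ⊨ ZF]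
    (a : M), DST.El A a ↔ DST.El B a) :
    ∃ f : A ⟶ B, Represents (DST.arrow f) (inclF A.formula) := by
  refine DST.exists_arrow _ fun M _ _ _ => ?_
  simp only [realize_inclF]
  refine ⟨?_, ?_, fun a ha => ⟨a, ha, rfl⟩⟩
  · rintro a b ⟨ha, rfl⟩
    exact ⟨ha, (h M a).1 ha⟩
  · rintro a b b' ⟨-, rfl⟩ ⟨-, rfl⟩
    rfl

/-- The canonical arrow between definable sets with the same elements. -/
noncomputable def inclusion {A B : DST} (h : ∀ (M : Type) [Nonempty M] [LSet.Structure M]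
    [M ⊨ ZF] (a : M), DST.El A a ↔ DST.El B a) : A ⟶ B := (exists_inclusion h).choose

theorem represents_inclusion {A B : DST} (h : ∀ (M : Type) [Nonempty M] [LSet.Structure M]
    [M ⊨ ZF] (a : M), DST.El A a ↔ DST.El B a) :
    Represents (DST.arrow (inclusion h)) (inclF A.formula) := (exists_inclusion h).choose_spec

theorem graph_inclusion {A B : DST} (h : ∀ (M : Type) [Nonempty M] [LSet.Structure M]
    [M ⊨ ZF] (a : M), DST.El A a ↔ DST.El B a) {M : Type} [Nonempty M] [LSet.Structure M]
    [M ⊨ ZF] {a b : M} : DST.Graph (inclusion h) a b ↔ DST.El A a ∧ a = b :=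
  (DST.represents_iff.1 (represents_inclusion h) M a b).symm.trans realize_inclF

theorem inclusion_comp_inclusion {A B : DST} (h : ∀ (M : Type) [Nonempty M] [LSet.Structure M]
    [M ⊨ ZF] (a : M), DST.El A a ↔ DST.El B a) :
    inclusion h ≫ inclusion (fun M _ _ _ a => (h M a).symm) = 𝟙 A :=
  DST.hom_ext fun M _ _ _ a b => by
    simp only [DST.graph_comp, graph_inclusion, DST.graph_id]
    rintro ⟨_, ⟨ha, rfl⟩, -, rfl⟩
    exact ⟨ha, rfl⟩

theorem el_ofGamma_toGamma {A : DST} (M : Type) [Nonempty M] [LSet.Structure M] [M ⊨ ZF] (a : M) :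
    DST.El A a ↔ DST.El ((toGamma ⋙ ofGamma hrep).obj A) a :=
  ((el_ofGammaObj hrep).trans el_toGammaObj).symm

/-- The unit of the equivalence. -/
noncomputable def unit : 𝟭 DST ≅ toGamma ⋙ ofGamma hrep :=
  NatIso.ofComponents
    (fun A => ⟨inclusion (el_ofGamma_toGamma hrep), inclusion fun M _ _ _ a =>
      (el_ofGamma_toGamma hrep M a).symm, inclusion_comp_inclusion _, inclusion_comp_inclusion _⟩)
    -- Naturality holds because the components have identity graphs and the composite functor
    -- preserves the graph of `f`.
    fun {A B} f => DST.hom_ext fun M _ _ _ a b => by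
      have h : DST.Graph ((toGamma ⋙ ofGamma hrep).map f) a b ↔ DST.Graph f a b :=
        (graph_ofGammaMap hrep).trans graph_toGammaMap
      simp only [DST.graph_comp, graph_inclusion]
      rintro ⟨_, hab, -, rfl⟩
      exact ⟨a, ⟨DST.Graph.el hab |>.1, rfl⟩, h.2 hab⟩

theorem toGamma_ofGamma_obj (X : GammaSET) :
    (ofGamma hrep ⋙ toGamma).obj X = (𝟭 GammaSET).obj X :=
  GammaSET.obj_ext fun _ _ _ _ _ => el_toGammaObj.trans (el_ofGammaObj hrep)

/-- An equality of functors: objects agree by their elements, and arrows agree after transport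
because both functors preserve graphs and transports leave them unchanged. -/
theorem ofGamma_comp_toGamma : ofGamma hrep ⋙ toGamma = 𝟭 GammaSET :=
  CategoryTheory.Functor.ext (toGamma_ofGamma_obj hrep) fun _ _ _ =>
    GammaSET.hom_ext fun _ _ _ _ _ _ =>
      (graph_toGammaMap.trans (graph_ofGammaMap hrep)).trans
        ((GammaSET.graph_eqToHom_comp _ _).trans (GammaSET.graph_comp_eqToHom _ _)).symm

/-- The equivalence of `DST[ZF]` and `Γ(SET)` given by a choice of representing formulas. -/
noncomputable def equivalence : DST ≌ GammaSET where
  functor := toGamma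
  inverse := ofGamma hrep
  unitIso := unit hrep
  counitIso := eqToIso (ofGamma_comp_toGamma hrep)
  functor_unitIso_comp A := GammaSET.hom_ext fun M _ _ _ a b => by
    -- The counit is a transport and drops out of the graph. The triangle identity then says that
    -- the image of a unit component has the graph of the identity.
    rw [eqToIso.hom, eqToHom_app, GammaSET.graph_comp_eqToHom, GammaSET.graph_id]
    exact graph_toGammaMap.trans ((graph_inclusion (el_ofGamma_toGamma hrep)).trans
      (and_congr el_toGammaObj.symm Iff.rfl))

end OfGamma

/-! ### Representing formulas of objects and arrows -/

theorem exists_obj_names_iff (P : Fml (Fin 1)) :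
    (∃ X : GammaSET, Names X.name P) ↔ Provable ZF (existsUniqueF P) := by
  rw [provable_existsUniqueF]
  constructor
  · rintro ⟨X, hX⟩ M _ _ _
    obtain ⟨a, ha⟩ := exists_val M (R := fv 0 ≐ fv 0) X.name
    have h := names_iff.1 hX M
    exact ⟨a, (h a).2 ha, fun b hb => Val.unique ((h b).1 hb) ha⟩
  · intro h
    -- The class of all sets imposes only `x = x`, so unique existence is the whole condition.
    obtain ⟨f, hf⟩ := exists_names_of (R := fv 0 ≐ fv 0) fun M _ _ _ => ⟨h M, fun _ _ => rfl⟩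
    exact ⟨⟨f⟩, hf⟩

theorem exists_hom_names_iff (Q : Fml (Fin 1)) :
    (∃ (X Y : GammaSET) (g : X ⟶ Y), Names g.name Q) ↔
      Provable ZF (existsUniqueF Q) ∧ Entails ZF Q set₁.formula := by
  refine Iff.trans ?_ (and_congr provable_existsUniqueF entails_iff).symm
  constructor
  · rintro ⟨X, Y, g, hg⟩
    have h := names_iff.1 hg
    refine ⟨fun M _ _ _ => ?_, fun M _ _ _ v hv => ?_⟩
    · obtain ⟨a, ha⟩ := exists_val M (R := set₁.formula) g.name
      exact ⟨a, (h M a).2 ha, fun b hb => Val.unique ((h M b).1 hb) ha⟩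
    · rw [eq_of_zero (x := v) (y := fun _ => v 0) rfl] at hv ⊢
      exact ((h M _).1 hv).holds
  · rintro ⟨h, h'⟩
    obtain ⟨f, hf⟩ := exists_names_of (R := set₁.formula) fun M _ _ _ => ⟨h M, fun a => h' M _⟩
    -- Source and target are not prescribed, so they are taken to be the internal domain and
    -- codomain of the global element.
    exact ⟨⟨f ≫ SetCat.d₀⟩, ⟨f ≫ SetCat.d₁⟩, ⟨f, rfl, rfl⟩, hf⟩

end DefSet

theorem mainTheorem2 :
    (∀ P : Fml (Fin 1), (∃ X : GammaSET, Names X.name P) ↔ Provable ZF (existsUniqueF P)) ∧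
    (∀ Q : Fml (Fin 1), (∃ (X Y : GammaSET) (g : X ⟶ Y), Names g.name Q) ↔
      Provable ZF (existsUniqueF Q) ∧ Entails ZF Q set₁.formula) ∧
    ∀ rep : GammaSET → Fml (Fin 1), (∀ X, Names X.name (rep X)) →
      ∃ e : DST ≌ GammaSET,
        (∀ A : DST, Names (e.functor.obj A).name (nameF A.formula)) ∧
        (∀ (A B : DST) (f : A ⟶ B) (F : Fml (Fin 1 ⊕ Fin 1)), Represents (DST.arrow f) F →
          Names (e.functor.map f).name (mapNameF F B.formula)) ∧
        (∀ X : GammaSET, (e.inverse.obj X).formula = elemF (rep X)) ∧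
        (∀ (X Y : GammaSET) (g : X ⟶ Y) (Q : Fml (Fin 1)), Names g.name Q →
          Represents (DST.arrow (e.inverse.map g)) (graphF Q)) ∧
        (∀ A : DST, Represents (DST.arrow (e.unit.app A)) (inclF A.formula)) ∧
        e.inverse ⋙ e.functor = 𝟭 GammaSET := by
  refine ⟨exists_obj_names_iff, exists_hom_names_iff, fun rep hrep => ⟨equivalence hrep,
    names_toGammaObj, fun A B f F hF => ?_, fun X => rfl, fun X Y g Q hQ => ?_,
    fun A => represents_inclusion (el_ofGamma_toGamma hrep), ofGamma_comp_toGamma hrep⟩⟩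
  -- The representative `F` is arbitrary here and need not be the one used to construct the functor.
  · exact names_map (names_toGammaObj A) (names_toGammaObj B)
      (fun M _ _ _ a b => graph_toGammaMap) hF
  · exact DST.represents_iff.2 fun M _ _ _ a b =>
      (realize_graphF_iff hQ).trans (graph_ofGammaMap hrep).symm
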